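/- Let $V$ be the $5$-dimensional real vector space of symmetric real $3\times 3$ matrices $\sigma=(\sigma_{kl})$ with $\sigma_{22}=\sigma_{13}+\sigma_{31}$. Let $E_{kl}$ be the matrix units and let $$\sigma_1=2E_{11},\quad \sigma_2=E_{12}+E_{21},\quad \sigma_3=E_{13}+2E_{22}+E_{31},\quad \sigma_4=E_{23}+E_{32},\quad \sigma_5=2E_{33},$$ a basis of $V$. Let $W\subset\wedge^2 V$ be the subspace spanned by $$\sigma_1\wedge\sigma_4-\sigma_2\wedge\sigma_3,\qquad \sigma_1\wedge\sigma_5-\sigma_2\wedge\sigma_4,\qquad \sigma_2\wedge\sigma_5-\sigma_3\wedge\sigma_4 .$$ Let $\mathcal G=V\oplus(\wedge^2V)/W$ be the 2-step nilpotent Lie algebra with bracket $[(v,z),(v',z')]=(0,\ v\wedge v' \bmod W)$, and let $G$ be the simply connected Lie group with Lie algebra $\mathcal G$. The quotient $G/[G,G]$ is canonically identified with the vector space $V$. Every continuous automorphism $\tau$ of $G$ induces a linear automorphism $\overline\tau$ of $V=G/[G,G]$. (1) If $\tau$ is a continuous automorphism of $G$ such that $\det\overline\tau=1$, then there is a nonzero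 $v\in V$ with $\overline\tau(v)=v$. (2) Let $\Gamma$ be a lattice in $G$ (a discrete subgroup such that $G/\Gamma$ is compact), let $\tau$ be a continuous automorphism of $G$ with $\tau(\Gamma)=\Gamma$, and let $\pi(\tau):G/\Gamma\to G/\Gamma$, $g\Gamma\mapsto\tau(g)\Gamma$, be the factor of $\tau$. Then $\pi(\tau)$ is not an Anosov diffeomorphism of the compact manifold $G/\Gamma$, and it is not ergodic with respect to the $G$-invariant Borel probability measure on $G/\Gamma$. -/

import Mathlib

open MeasureTheory
open scoped Manifold ContDiff

noncomputable section

namespace TwoStep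

/-! ### The 2-step nilpotent Lie algebra and Lie group attached to `W ≤ ⋀² V` -/

section General

variable {V : Type} [AddCommGroup V] [Module ℝ V]

/-- The exterior product `v ∧ w`, an element of `⋀² V`, as a bilinear map. -/
def wedge : V →ₗ[ℝ] V →ₗ[ℝ] ⋀[ℝ]^2 V :=
  LinearMap.mk₂ ℝ (fun v w => exteriorPower.ιMulti ℝ 2 ![v, w])
    (fun v₁ v₂ w => by
      simpa using (exteriorPower.ιMulti ℝ 2 (M := V)).map_vecCons_add ![w] v₁ v₂)
    (fun c v w => by
      simpa using (exteriorPower.ιMulti ℝ 2 (M := V)).map_vecCons_smul ![w] c v)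
    (fun v w₁ w₂ => by
      have h := (exteriorPower.ιMulti ℝ 2 (M := V)).map_update_add ![v, 0] 1 w₁ w₂
      have e : ∀ w : V, Function.update ![v, 0] 1 w = ![v, w] := by
        intro w; ext i; fin_cases i <;> simp
      simpa only [e] using h)
    (fun c v w => by
      have h := (exteriorPower.ιMulti ℝ 2 (M := V)).map_update_smul ![v, 0] 1 c w
      have e : ∀ w : V, Function.update ![v, 0] 1 w = ![v, w] := by
        intro w; ext i; fin_cases i <;> simp
      simpa only [e] using h)

lemma wedge_apply (v w : V) : wedge v w = exteriorPower.ιMulti ℝ 2 ![v, w] := rfl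

lemma wedge_self (v : V) : wedge v v = 0 := by
  rw [wedge_apply]
  exact (exteriorPower.ιMulti ℝ 2 (M := V)).map_eq_zero_of_eq ![v, v]
    (i := 0) (j := 1) (by simp) (by decide)

lemma wedge_swap (v w : V) : wedge w v = -wedge v w := by
  have h := wedge_self (v + w)
  simp only [map_add, LinearMap.add_apply, wedge_self, zero_add, add_zero] at h
  exact eq_neg_of_add_eq_zero_left h

/-- The Lie algebra `V ⊕ (⋀² V)/W`. -/
def LieAlg (W : Submodule ℝ (⋀[ℝ]^2 V)) : Type := V × ((⋀[ℝ]^2 V) ⧸ W)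

variable (W : Submodule ℝ (⋀[ℝ]^2 V))

instance : AddCommGroup (LieAlg W) := inferInstanceAs (AddCommGroup (V × ((⋀[ℝ]^2 V) ⧸ W)))
instance : Module ℝ (LieAlg W) := inferInstanceAs (Module ℝ (V × ((⋀[ℝ]^2 V) ⧸ W)))
instance [Module.Finite ℝ V] : Module.Finite ℝ (LieAlg W) :=
  inferInstanceAs (Module.Finite ℝ (V × ((⋀[ℝ]^2 V) ⧸ W)))

/-- `[(v, z), (v', z')] = (0, v ∧ v' mod W)`, as a bilinear map. -/
def bracket : LieAlg W →ₗ[ℝ] LieAlg W →ₗ[ℝ] LieAlg W :=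
  ((wedge (V := V)).compr₂ (LinearMap.inr ℝ V _ ∘ₗ W.mkQ)).compl₁₂
    (LinearMap.fst ℝ V ((⋀[ℝ]^2 V) ⧸ W)) (LinearMap.fst ℝ V ((⋀[ℝ]^2 V) ⧸ W))

lemma bracket_apply (x y : LieAlg W) :
    bracket W x y = ((0 : V), W.mkQ (wedge x.1 y.1)) := rfl

lemma bracket_self (x : LieAlg W) : bracket W x x = 0 := by
  rw [bracket_apply, wedge_self, map_zero]; rfl

lemma bracket_bracket_left (x y z : LieAlg W) : bracket W (bracket W x y) z = 0 := by
  rw [bracket_apply W _ z, show (bracket W x y).1 = (0 : V) from rfl, map_zero,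
    LinearMap.zero_apply, map_zero]
  rfl

lemma bracket_bracket_right (x y z : LieAlg W) : bracket W x (bracket W y z) = 0 := by
  rw [bracket_apply W x, show (bracket W y z).1 = (0 : V) from rfl, map_zero, map_zero]
  rfl

instance : LieRing (LieAlg W) where
  bracket x y := bracket W x y
  add_lie x y z := by simp
  lie_add x y z := by simp
  lie_self x := bracket_self W x
  leibniz_lie x y z := by
    simp only [bracket_bracket_left, bracket_bracket_right, add_zero]

lemma lie_def (x y : LieAlg W) : ⁅x, y⁆ = bracket W x y := rfl

instance : LieAlgebra ℝ (LieAlg W) where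
  lie_smul c x y := by simp [lie_def]

/-- A norm on the finite-dimensional space `V ⊕ (⋀² V)/W` (the sup norm of coordinates);
only its topology, which does not depend on choices, matters below. -/
instance [Module.Finite ℝ V] : NormedAddCommGroup (LieAlg W) :=
  NormedAddCommGroup.induced (LieAlg W) (Fin (Module.finrank ℝ (LieAlg W)) → ℝ)
    (Module.finBasis ℝ (LieAlg W)).equivFun (LinearEquiv.injective _)

instance [Module.Finite ℝ V] : NormedSpace ℝ (LieAlg W) where
  norm_smul_le c x := by
    change ‖(Module.finBasis ℝ (LieAlg W)).equivFun (c • x)‖ ≤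
      ‖c‖ * ‖(Module.finBasis ℝ (LieAlg W)).equivFun x‖
    rw [map_smul, norm_smul]

/-- The simply connected Lie group with Lie algebra `V ⊕ (⋀² V)/W`, in exponential coordinates:
the underlying manifold is the Lie algebra, and the product is given by the
Baker–Campbell–Hausdorff formula, which for a 2-step nilpotent Lie algebra is
`x * y = x + y + [x, y] / 2`. -/
def NilGroup : Type := LieAlg W

variable {W}

/-- The exponential map, which is the identity in exponential coordinates. -/
def exp : LieAlg W ≃ NilGroup W := Equiv.refl _

/-- The inverse of the exponential map. -/
def log : NilGroup W ≃ LieAlg W := Equiv.refl _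

variable (W)

instance : Mul (NilGroup W) where
  mul x y := exp (log x + log y + (1 / 2 : ℝ) • ⁅log x, log y⁆)

instance : One (NilGroup W) where
  one := exp 0

instance : Inv (NilGroup W) where
  inv x := exp (-log x)

variable {W} in
lemma log_mul (x y : NilGroup W) :
    log (x * y) = log x + log y + (1 / 2 : ℝ) • ⁅log x, log y⁆ := rfl

variable {W} in
lemma log_inv (x : NilGroup W) : log x⁻¹ = -log x := rfl

lemma log_one : log (1 : NilGroup W) = 0 := rfl

instance : Group (NilGroup W) where
  mul_assoc x y z := by
    apply log.injective
    simp only [log_mul, lie_def, map_add, LinearMap.add_apply, map_smul, LinearMap.smul_apply,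
      bracket_bracket_left, bracket_bracket_right, smul_zero, add_zero, smul_add]
    abel
  one_mul x := by
    apply log.injective
    simp [log_mul, log_one]
  mul_one x := by
    apply log.injective
    simp [log_mul, log_one]
  inv_mul_cancel x := by
    apply log.injective
    simp [log_mul, log_one, log_inv]

instance [Module.Finite ℝ V] : TopologicalSpace (NilGroup W) :=
  inferInstanceAs (TopologicalSpace (LieAlg W))

instance [Module.Finite ℝ V] : T2Space (NilGroup W) :=
  inferInstanceAs (T2Space (LieAlg W))

instance [Module.Finite ℝ V] : ChartedSpace (LieAlg W) (NilGroup W) :=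
  inferInstanceAs (ChartedSpace (LieAlg W) (LieAlg W))

instance [Module.Finite ℝ V] : IsManifold 𝓘(ℝ, LieAlg W) ∞ (NilGroup W) :=
  inferInstanceAs (IsManifold 𝓘(ℝ, LieAlg W) ∞ (LieAlg W))

lemma contDiff_bracket [Module.Finite ℝ V] :
    ContDiff ℝ ∞ (fun p : LieAlg W × LieAlg W => ⁅p.1, p.2⁆) :=
  ((LinearMap.toContinuousBilinearMap (bracket W)).isBoundedBilinearMap).contDiff

instance [Module.Finite ℝ V] : LieGroup 𝓘(ℝ, LieAlg W) ∞ (NilGroup W) where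
  contMDiff_mul := by
    have h : ContDiff ℝ ∞ (fun p : LieAlg W × LieAlg W =>
        p.1 + p.2 + (1 / 2 : ℝ) • ⁅p.1, p.2⁆) :=
      (contDiff_fst.add contDiff_snd).add ((contDiff_bracket W).const_smul _)
    have h' : ContMDiff (𝓘(ℝ, LieAlg W).prod 𝓘(ℝ, LieAlg W)) 𝓘(ℝ, LieAlg W) ∞
        (fun p : LieAlg W × LieAlg W => p.1 + p.2 + (1 / 2 : ℝ) • ⁅p.1, p.2⁆) :=
      h.contMDiff.comp (contMDiff_fst.prodMk_space contMDiff_snd)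
    exact h'
  contMDiff_inv := by
    have h : ContDiff ℝ ∞ (fun p : LieAlg W => -p) := contDiff_neg
    exact h.contMDiff

instance [Module.Finite ℝ V] : IsTopologicalGroup (NilGroup W) :=
  topologicalGroup_of_lieGroup 𝓘(ℝ, LieAlg W) ∞

/-! ### The quotient `V` of the group by its commutator subgroup -/

/-- The projection of the group onto `V`, a homomorphism. -/
def proj : NilGroup W →* Multiplicative V where
  toFun x := Multiplicative.ofAdd (log x).1
  map_one' := rfl
  map_mul' x y := by
    change Multiplicative.ofAdd ((log x).1 + (log y).1 + (1 / 2 : ℝ) • (0 : V)) = _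
    rw [smul_zero, add_zero]; rfl

lemma proj_surjective : Function.Surjective (proj W) := fun v =>
  ⟨exp ((Multiplicative.toAdd v, 0) : V × ((⋀[ℝ]^2 V) ⧸ W)), rfl⟩

open scoped commutatorElement in
variable {W} in
lemma log_commutatorElement (x y : NilGroup W) : log ⁅x, y⁆ = ⁅log x, log y⁆ := by
  have h : ⁅x, y⁆ = exp ⁅log x, log y⁆ := by
    rw [commutatorElement_def, mul_inv_eq_iff_eq_mul, mul_inv_eq_iff_eq_mul]
    apply log.injective
    have e : ∀ a : LieAlg W, log (exp a) = a := fun _ => rfl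
    simp only [log_mul, e, lie_def, map_add, LinearMap.add_apply, bracket_bracket_left, smul_zero,
      add_zero]
    have hs : bracket W (log y) (log x) = -bracket W (log x) (log y) := by
      rw [← lie_def, ← lie_def, lie_skew]
    rw [hs]
    module
  rw [h]; rfl

open scoped commutatorElement in
/-- The kernel of the projection onto `V` is `[G, G]`, so that it identifies `G/[G, G]`
with `V`. -/
theorem ker_proj : (proj W).ker = commutator (NilGroup W) := by
  apply le_antisymm
  · have key : ∀ u : ⋀[ℝ]^2 V, ∀ c : ℝ,
        (exp (((0 : V), W.mkQ (c • u)) : V × ((⋀[ℝ]^2 V) ⧸ W)) : NilGroup W) ∈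
          commutator (NilGroup W) := by
      intro u
      have hu : u ∈ Submodule.span ℝ (Set.range (exteriorPower.ιMulti ℝ 2 (M := V))) := by
        rw [exteriorPower.ιMulti_span]; trivial
      induction hu using Submodule.span_induction with
      | mem u h =>
        obtain ⟨v, rfl⟩ := h
        intro c
        let x : NilGroup W := exp ((c • v 0, 0) : V × ((⋀[ℝ]^2 V) ⧸ W))
        let y : NilGroup W := exp ((v 1, 0) : V × ((⋀[ℝ]^2 V) ⧸ W))
        have hxy : (exp (((0 : V), W.mkQ (c • exteriorPower.ιMulti ℝ 2 v)) :
            V × ((⋀[ℝ]^2 V) ⧸ W)) : NilGroup W) = ⁅x, y⁆ := by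
          apply log.injective
          rw [log_commutatorElement, lie_def, bracket_apply]
          have hv : ![v 0, v 1] = v := by ext i; fin_cases i <;> rfl
          have : wedge (c • v 0) (v 1) = c • exteriorPower.ιMulti ℝ 2 v := by
            rw [map_smul, LinearMap.smul_apply, wedge_apply, hv]
          change _ = ((0 : V), W.mkQ (wedge (c • v 0) (v 1)))
          rw [this]; rfl
        rw [hxy]
        exact Subgroup.commutator_mem_commutator (Subgroup.mem_top _) (Subgroup.mem_top _)
      | zero => intro c; rw [smul_zero, map_zero]; exact one_mem _
      | add a b _ _ ha hb =>
        intro c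
        have := mul_mem (ha c) (hb c)
        convert this using 1
        apply log.injective
        rw [log_mul, lie_def, bracket_apply]
        change ((0 : V), W.mkQ (c • (a + b))) = ((0 : V), W.mkQ (c • a)) +
          ((0 : V), W.mkQ (c • b)) + (1 / 2 : ℝ) • ((0 : V), W.mkQ (wedge (0 : V) (0 : V)))
        simp
      | smul r a _ ha => intro c; rw [smul_smul]; exact ha _
    intro x hx
    obtain ⟨u, hu⟩ := W.mkQ_surjective (log x).2
    have h1 : (log x).1 = (0 : V) := hx
    have := key u 1
    rw [one_smul, hu, ← h1] at this
    exact this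
  · exact Abelianization.commutator_subset_ker (proj W)

variable {W}

lemma proj_apply_eq [Module.Finite ℝ V] (τ : NilGroup W ≃ₜ* NilGroup W) {x y : NilGroup W}
    (h : proj W x = proj W y) : proj W (τ x) = proj W (τ y) := by
  have hx : x⁻¹ * y ∈ commutator (NilGroup W) := by
    rw [← ker_proj, MonoidHom.mem_ker, map_mul, map_inv, h, inv_mul_cancel]
  have h2 := Abelianization.commutator_subset_ker
    ((proj W).comp (τ.toMulEquiv : NilGroup W →* NilGroup W)) hx
  rw [MonoidHom.mem_ker, map_mul, map_inv, inv_mul_eq_one] at h2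
  exact h2

lemma log_apply_smul [Module.Finite ℝ V] (τ : NilGroup W ≃ₜ* NilGroup W) (c : ℝ)
    (X : LieAlg W) : log (τ (exp (c • X))) = c • log (τ (exp X)) := by
  let f : ℝ →+ LieAlg W :=
    { toFun := fun t => log (τ (exp (t • X)))
      map_zero' := by
        rw [zero_smul]
        change log (τ 1) = 0
        rw [map_one]; rfl
      map_add' := by
        have hm : ∀ s t : ℝ, (exp ((s + t) • X) : NilGroup W) = exp (s • X) * exp (t • X) := by
          intro s t
          apply log.injective
          rw [log_mul]
          change (s + t) • X = s • X + t • X + (1 / 2 : ℝ) • ⁅s • X, t • X⁆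
          simp [add_smul]
        have hl : ∀ s t : ℝ, log (τ (exp ((s + t) • X))) = log (τ (exp (s • X))) +
            log (τ (exp (t • X))) +
              (1 / 2 : ℝ) • ⁅log (τ (exp (s • X))), log (τ (exp (t • X)))⁆ := by
          intro s t
          rw [hm, map_mul, log_mul]
        intro s t
        have h1 := hl s t
        have h2 := hl t s
        rw [add_comm t s, h1, add_comm (log (τ (exp (t • X)))), add_right_inj,
          ← lie_skew, smul_neg, neg_eq_iff_add_eq_zero, ← two_smul ℝ, smul_smul] at h2
        rw [h1, ← lie_skew, smul_neg]
        norm_num at h2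
        rw [h2]
        simp }
  have hf : Continuous f := by
    have h1 : Continuous (fun t : ℝ => t • X) := by fun_prop
    exact τ.continuous.comp h1
  have := map_real_smul f hf c 1
  simpa [f] using this

/-- The factor on `V = G/[G, G]` of a continuous automorphism `τ` of `G`; it is characterized
by `factor_proj`. -/
def factor [Module.Finite ℝ V] (τ : NilGroup W ≃ₜ* NilGroup W) : V →ₗ[ℝ] V where
  toFun v := (proj W (τ (exp ((v, 0) : V × ((⋀[ℝ]^2 V) ⧸ W))))).toAdd
  map_add' v w := by
    rw [← toAdd_mul, ← map_mul, ← map_mul]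
    congr 1
    apply proj_apply_eq
    rw [map_mul]; rfl
  map_smul' c v := by
    have h := log_apply_smul τ c ((v, 0) : V × ((⋀[ℝ]^2 V) ⧸ W))
    have e : (exp ((c • v, 0) : V × ((⋀[ℝ]^2 V) ⧸ W)) : NilGroup W) =
        exp (c • (((v, 0) : V × ((⋀[ℝ]^2 V) ⧸ W)) : LieAlg W)) := by
      congr 1
      change _ = (c • v, c • (0 : (⋀[ℝ]^2 V) ⧸ W))
      rw [smul_zero]
    rw [e]
    exact congrArg Prod.fst h

theorem factor_proj [Module.Finite ℝ V] (τ : NilGroup W ≃ₜ* NilGroup W) (x : NilGroup W) :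
    factor τ (proj W x).toAdd = (proj W (τ x)).toAdd := by
  change (proj W (τ _)).toAdd = _
  congr 1
  exact proj_apply_eq τ rfl

/-! ### Nilmanifolds `G/Γ` -/

section Quotient

variable [Module.Finite ℝ V] (Γ : Subgroup (NilGroup W))

lemma isLocalHomeomorph_mk [DiscreteTopology Γ] :
    IsLocalHomeomorph (QuotientGroup.mk : NilGroup W → NilGroup W ⧸ Γ) :=
  (Γ.isQuotientCoveringMap ⟨inferInstance⟩).isCoveringMap.isLocalHomeomorph

/-- The manifold structure on `G/Γ`, `Γ` discrete: charts are local inverses of `G → G/Γ`. -/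
instance [DiscreteTopology Γ] : ChartedSpace (LieAlg W) (NilGroup W ⧸ Γ) :=
  (isLocalHomeomorph_mk Γ).chartedSpaceOfRightInverse (g := Quotient.out)
    (fun q => Quotient.out_eq q)

instance [DiscreteTopology Γ] : IsManifold 𝓘(ℝ, LieAlg W) ∞ (NilGroup W ⧸ Γ) := by
  apply isManifold_of_contDiffOn
  rintro _ _ ⟨p, rfl⟩ ⟨q, rfl⟩
  have hloc := isLocalHomeomorph_mk Γ
  set a := hloc.localInverseAt (Quotient.out p) with ha
  set b := hloc.localInverseAt (Quotient.out q) with hb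
  let mk : NilGroup W → NilGroup W ⧸ Γ := QuotientGroup.mk
  -- the transition map sends `u` to `b (uΓ)`, which locally is a right translation
  let φ : LieAlg W → LieAlg W := fun u => log (b (mk (exp u)))
  have hsymm : ∀ u : NilGroup W, a.symm u = mk u :=
    fun u => congrFun (hloc.localInverseAt_symm _) u
  have hsource : ∀ u : LieAlg W,
      u ∈ ((a.trans (chartAt (LieAlg W) (Quotient.out p))).symm.trans
        (b.trans (chartAt (LieAlg W) (Quotient.out q)))).source → mk (exp u) ∈ b.source := by
    intro u hu
    have h2 : a.symm (exp u) ∈ b.source := hu.2.1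
    rwa [hsymm] at h2
  have hopen : IsOpen ((a.trans (chartAt (LieAlg W) (Quotient.out p))).symm.trans
        (b.trans (chartAt (LieAlg W) (Quotient.out q)))).source :=
    OpenPartialHomeomorph.open_source _
  set O := ((a.trans (chartAt (LieAlg W) (Quotient.out p))).symm.trans
        (b.trans (chartAt (LieAlg W) (Quotient.out q)))).source with hO
  have hφ : ContDiffOn ℝ ∞ φ O := by
    intro u₀ hu₀
    let g : NilGroup W → NilGroup W := fun u => u⁻¹ * b (mk u)
    have hg : ∀ u ∈ O, g (exp u) ∈ Γ := by
      intro u hu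
      have h3 : mk (b (mk (exp u))) = mk (exp u) :=
        hloc.apply_localInverseAt_of_mem (hsource u hu)
      exact QuotientGroup.eq.1 h3.symm
    have hgc : ContinuousAt g (exp u₀) := by
      have h4 : ContinuousAt b (mk (exp u₀)) := b.continuousAt (hsource u₀ hu₀)
      have h5 : ContinuousAt mk (exp u₀) := QuotientGroup.continuous_mk.continuousAt
      exact continuousAt_id.inv.mul (h4.comp h5)
    obtain ⟨N, hN, hNΓ⟩ : ∃ N ∈ nhds (g (exp u₀)), ∀ x ∈ N, x ∈ Γ → x = g (exp u₀) := by
      have h6 : IsDiscrete (Γ : Set (NilGroup W)) := ⟨inferInstance⟩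
      obtain ⟨N, hN, hN'⟩ :=
        isDiscrete_iff_forall_mem_exists_isOpen.1 h6 (g (exp u₀)) (hg u₀ hu₀)
      have h7 : g (exp u₀) ∈ N ∩ Γ := hN' ▸ Set.mem_singleton _
      refine ⟨N, hN.mem_nhds h7.1, fun x hx hx' => ?_⟩
      have h8 : x ∈ N ∩ (Γ : Set (NilGroup W)) := ⟨hx, hx'⟩
      rwa [hN'] at h8
    have h8 : ∀ᶠ u in nhds u₀, φ u = log (exp u * g (exp u₀)) := by
      have h9 : ∀ᶠ u in nhds u₀, g (exp u) ∈ N := hgc hN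
      filter_upwards [h9, hopen.mem_nhds hu₀] with u h10 h11
      rw [← hNΓ _ h10 (hg u h11)]
      simp only [g, mul_inv_cancel_left, φ]
    have h12 : ContDiff ℝ ∞ (fun u : LieAlg W => log (exp u * g (exp u₀))) :=
      (contMDiff_mul_right (I := 𝓘(ℝ, LieAlg W)) (n := ∞) (a := g (exp u₀))).contDiff
    exact (h12.contDiffAt.congr_of_eventuallyEq h8).contDiffWithinAt
  refine hφ.congr_mono ?_ ?_
  · intro u _
    exact congrArg b (hsymm (exp u))
  · intro u hu
    exact hu.1

instance : MeasurableSpace (NilGroup W ⧸ Γ) := borel _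

instance : BorelSpace (NilGroup W ⧸ Γ) := ⟨rfl⟩

variable {Γ} in
/-- The factor `gΓ ↦ τ(g)Γ` on `G/Γ` of an automorphism `τ` of `G` with `τ(Γ) = Γ`. -/
def quotientMap (τ : NilGroup W ≃ₜ* NilGroup W) (hτ : τ '' (Γ : Set (NilGroup W)) = Γ) :
    NilGroup W ⧸ Γ → NilGroup W ⧸ Γ :=
  Quotient.map' τ fun x y h => by
    rw [QuotientGroup.leftRel_apply] at h ⊢
    rw [← map_inv, ← map_mul, ← SetLike.mem_coe, ← hτ]
    exact Set.mem_image_of_mem τ h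

end Quotient

end General

/-! ### The pair `V`, `W` -/

/-- The space `V` of symmetric real `3 × 3` matrices `σ` with `σ₂₂ = σ₁₃ + σ₃₁`
(matrix indices `1, 2, 3` are written `0, 1, 2`). -/
def V : Submodule ℝ (Matrix (Fin 3) (Fin 3) ℝ) where
  carrier := {σ | σ.IsSymm ∧ σ 1 1 = σ 0 2 + σ 2 0}
  add_mem' {a b} ha hb := ⟨ha.1.add hb.1, by
    simp only [Matrix.add_apply, ha.2, hb.2]; ring⟩
  zero_mem' := ⟨Matrix.isSymm_zero, by simp⟩
  smul_mem' c a ha := ⟨ha.1.smul c, by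
    simp only [Matrix.smul_apply, smul_eq_mul, ha.2]; ring⟩

/-- `σ₁ = 2 E₁₁`. -/
def σ₁ : V := ⟨!![2, 0, 0; 0, 0, 0; 0, 0, 0], by
  refine ⟨?_, by simp⟩; ext i j; fin_cases i <;> fin_cases j <;> rfl⟩

/-- `σ₂ = E₁₂ + E₂₁`. -/
def σ₂ : V := ⟨!![0, 1, 0; 1, 0, 0; 0, 0, 0], by
  refine ⟨?_, by simp⟩; ext i j; fin_cases i <;> fin_cases j <;> rfl⟩

/-- `σ₃ = E₁₃ + 2 E₂₂ + E₃₁`. -/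
def σ₃ : V := ⟨!![0, 0, 1; 0, 2, 0; 1, 0, 0], by
  refine ⟨?_, show (2 : ℝ) = 1 + 1 by norm_num⟩; ext i j; fin_cases i <;> fin_cases j <;> rfl⟩

/-- `σ₄ = E₂₃ + E₃₂`. -/
def σ₄ : V := ⟨!![0, 0, 0; 0, 0, 1; 0, 1, 0], by
  refine ⟨?_, by simp⟩; ext i j; fin_cases i <;> fin_cases j <;> rfl⟩

/-- `σ₅ = 2 E₃₃`. -/
def σ₅ : V := ⟨!![0, 0, 0; 0, 0, 0; 0, 0, 2], by
  refine ⟨?_, by simp⟩; ext i j; fin_cases i <;> fin_cases j <;> rfl⟩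

/-- The three-dimensional subspace `W` of `⋀² V`. -/
def W : Submodule ℝ (⋀[ℝ]^2 V) :=
  Submodule.span ℝ {wedge σ₁ σ₄ - wedge σ₂ σ₃, wedge σ₁ σ₅ - wedge σ₂ σ₄,
    wedge σ₂ σ₅ - wedge σ₃ σ₄}

/-- The 2-step simply connected nilpotent Lie group attached to `V` and `W`. -/
abbrev G : Type := NilGroup W

end TwoStep

/-- A self-map `f` of a `C¹` manifold `M` (used for compact `M`) is an Anosov diffeomorphism if it
is a `C¹` diffeomorphism and, for a continuous Riemannian metric on `M`, the tangent spaces split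
as `E^s ⊕ E^u` so that the splitting is invariant under the derivative `Df`, and, with constants
`C > 0` and `0 < r < 1`, `‖Dfⁿ v‖ ≤ C rⁿ ‖v‖` for `v ∈ E^s` and `‖v‖ ≤ C rⁿ ‖Dfⁿ v‖` for
`v ∈ E^u`, for all `n ≥ 0`. (The continuity of such a splitting is automatic.) -/
def IsAnosovDiffeomorph {E : Type*} [NormedAddCommGroup E] [NormedSpace ℝ E]
    {H : Type*} [TopologicalSpace H] (I : ModelWithCorners ℝ E H)
    {M : Type*} [TopologicalSpace M] [ChartedSpace H M] [IsManifold I 1 M] (f : M → M) : Prop :=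
  (∃ Φ : M ≃ₘ^1⟮I, I⟯ M, ⇑Φ = f) ∧
  ∃ (g : Bundle.ContinuousRiemannianMetric E (fun x : M => TangentSpace I x))
    (Es Eu : ∀ x : M, Submodule ℝ (TangentSpace I x)) (C r : ℝ),
    0 < C ∧ 0 < r ∧ r < 1 ∧
    ∀ x : M, IsCompl (Es x) (Eu x) ∧
      (Es x).map (mfderiv I I f x : TangentSpace I x →ₗ[ℝ] TangentSpace I (f x)) = Es (f x) ∧
      (Eu x).map (mfderiv I I f x : TangentSpace I x →ₗ[ℝ] TangentSpace I (f x)) = Eu (f x) ∧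
      (∀ v ∈ Es x, ∀ n : ℕ,
        √(g.inner (f^[n] x) (mfderiv I I f^[n] x v) (mfderiv I I f^[n] x v)) ≤
          C * r ^ n * √(g.inner x v v)) ∧
      (∀ v ∈ Eu x, ∀ n : ℕ,
        √(g.inner x v v) ≤
          C * r ^ n * √(g.inner (f^[n] x) (mfderiv I I f^[n] x v) (mfderiv I I f^[n] x v)))

end

/-!
For suitable generators `p₁, p₂, p₃` of `W` one has `pᵢ ∧ pⱼ ∧ v = -vᵢⱼ · vol` for every `v ∈ V`.
Hence, if a linear map `A` of `V` preserves `W` and `H` is its matrix on the `pᵢ`, then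
`Hᵀ A(v) H = det A · v`. Now `V` is, among symmetric matrices, the orthogonal for the trace pairing
of a nondegenerate conic `q`. So for `det A = 1` the matrix `H q Hᵀ` is a multiple of `q`, and
comparing determinants shows that it is `q` itself: `H` is orthogonal for `q`. As the size `3` is
odd, `det H = ±1` is an eigenvalue of `H`, and for an eigenvector `x` the linear form `v ↦ xᵀ v x`
is fixed by `A`. So `1` is an eigenvalue of `A`.

If `τ` preserves a lattice `Γ`, then `A = τ̄` preserves its image, which is a lattice in `V`. Hence
`det A = ±1`, and `A²` has a nonzero fixed vector. On the one hand `1` is then an eigenvalue of the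
derivative of `π(τ)²` at the base point, which is impossible for an Anosov diffeomorphism. On the
other hand `A²` then fixes a nonzero linear form `ψ` that is integral on the image of `Γ`, and the
continuous nonconstant function `cos (2πψ)` on `G/Γ` is invariant under `π(τ)²`.
-/

noncomputable section

open Matrix

/-- The linear form on the exterior algebra that is the determinant with respect to `b` in the top
degree `n` and zero in all other degrees. -/
def volumeForm {R M : Type*} [CommRing R] [AddCommGroup M] [Module R M] {n : ℕ}
    (b : Module.Basis (Fin n) R M) : ExteriorAlgebra R M →ₗ[R] R :=
  ExteriorAlgebra.liftAlternating (Pi.single n b.det)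

section VolumeForm

variable {R M : Type*} [CommRing R] [AddCommGroup M] [Module R M] {n : ℕ}
  (b : Module.Basis (Fin n) R M)

lemma volumeForm_ιMulti (v : Fin n → M) :
    volumeForm b (ExteriorAlgebra.ιMulti R n v) = b.det v := by
  rw [volumeForm, ExteriorAlgebra.liftAlternating_apply_ιMulti, Pi.single_eq_same]

lemma volumeForm_map (A : M →ₗ[R] M) (x : ExteriorAlgebra R M) :
    volumeForm b (ExteriorAlgebra.map A x) = LinearMap.det A * volumeForm b x := by
  suffices h : volumeForm b ∘ₗ (ExteriorAlgebra.map A).toLinearMap =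
      LinearMap.det A • volumeForm b from LinearMap.congr_fun h x
  refine ExteriorAlgebra.lhom_ext fun i => AlternatingMap.ext fun v => ?_
  simp only [LinearMap.compAlternatingMap_apply, LinearMap.comp_apply, AlgHom.toLinearMap_apply,
    LinearMap.smul_apply, ExteriorAlgebra.map_apply_ιMulti, smul_eq_mul, volumeForm,
    ExteriorAlgebra.liftAlternating_apply_ιMulti]
  rcases eq_or_ne i n with rfl | hi
  · rw [Pi.single_eq_same, Module.Basis.det_comp]
  · rw [Pi.single_eq_of_ne hi, AlternatingMap.zero_apply, AlternatingMap.zero_apply, mul_zero]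

end VolumeForm

section FixedForms

variable {R M : Type*} [CommRing R] [IsDomain R] [AddCommGroup M] [Module R M] [Module.Free R M]
  [Module.Finite R M]

lemma exists_fixed_ne_zero_iff_det (f : M →ₗ[R] M) :
    (∃ v, v ≠ 0 ∧ f v = v) ↔ LinearMap.det (f - LinearMap.id) = 0 := by
  simp only [LinearMap.det_eq_zero_iff_ker_ne_bot, Submodule.ne_bot_iff, LinearMap.mem_ker,
    LinearMap.sub_apply, LinearMap.id_apply, sub_eq_zero, and_comm]

lemma exists_fixed_ne_zero_iff_exists_fixed_form (f : M →ₗ[R] M) :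
    (∃ v, v ≠ 0 ∧ f v = v) ↔ ∃ χ : Module.Dual R M, χ ≠ 0 ∧ χ ∘ₗ f = χ := by
  have hdual : (f - LinearMap.id).dualMap = f.dualMap - LinearMap.id := by
    ext χ v
    exact map_sub χ (f v) v
  rw [exists_fixed_ne_zero_iff_det, ← LinearMap.det_dualMap, hdual, ← exists_fixed_ne_zero_iff_det]
  rfl

end FixedForms

lemma det_mul_self_eq_one_of_mul_mul_transpose {ι R : Type*} [Fintype ι] [DecidableEq ι]
    [CommRing R] [IsDomain R] {q H : Matrix ι ι R} (hq : q.det ≠ 0) (hH : H * q * Hᵀ = q) :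
    H.det * H.det = 1 := by
  have h := congrArg det hH
  rw [det_mul, det_mul, det_transpose] at h
  exact mul_right_cancel₀ hq (by linear_combination h)

lemma det_sub_det_smul_one_eq_zero {ι R : Type*} [Fintype ι] [DecidableEq ι] [CommRing R]
    [IsDomain R] [NeZero (2 : R)] (hι : Odd (Fintype.card ι)) {q H : Matrix ι ι R}
    (hq : q.det ≠ 0) (hH : H * q * Hᵀ = q) : (H - H.det • (1 : Matrix ι ι R)).det = 0 := by
  set ε := H.det
  have hε : ε * ε = 1 := det_mul_self_eq_one_of_mul_mul_transpose hq hH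
  have hcongr : (H - ε • 1) * q * Hᵀ = q * -(ε • (H - ε • 1)ᵀ) := by
    simp only [sub_mul, hH, smul_mul, one_mul, transpose_sub, transpose_smul, transpose_one,
      smul_sub, smul_smul, hε, neg_sub, mul_sub, mul_one, Matrix.mul_smul, one_smul]
  have hpow : ε ^ Fintype.card ι = ε := by
    obtain ⟨k, hk⟩ := hι
    rw [hk, pow_succ, pow_mul, sq, hε, one_pow, one_mul]
  have hdet := congrArg det hcongr
  rw [det_mul, det_mul, det_mul, det_neg, det_smul, det_transpose, det_transpose, hι.neg_one_pow,
    hpow] at hdet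
  have h2 : 2 * (H - ε • 1).det * (q.det * ε) = 0 := by linear_combination hdet
  have hne : q.det * ε ≠ 0 := mul_ne_zero hq (left_ne_zero_of_mul_eq_one hε)
  exact (mul_eq_zero.1 ((mul_eq_zero.1 h2).resolve_right hne)).resolve_left two_ne_zero

lemma pow_finrank_mul_det_sq_eq_one {K M : Type*} [Field K] [AddCommGroup M] [Module K M]
    [FiniteDimensional K M] {B : LinearMap.BilinForm K M} (hB : B.Nondegenerate) {A : M →ₗ[K] M}
    {c : K} (hA : c • B.comp A A = B) :
    c ^ Module.finrank K M * LinearMap.det A ^ 2 = 1 := by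
  let b := Module.finBasis K M
  have hdet := congrArg (fun B => (LinearMap.BilinForm.toMatrix b B).det) hA
  simp only [map_smul, LinearMap.BilinForm.toMatrix_comp b b, det_smul, det_mul, det_transpose,
    LinearMap.det_toMatrix, Fintype.card_fin] at hdet
  exact mul_right_cancel₀ ((LinearMap.BilinForm.nondegenerate_iff_det_ne_zero b).1 hB)
    (by linear_combination hdet)

lemma coe_exteriorPower_map {R M N : Type*} [CommRing R] [AddCommGroup M] [Module R M]
    [AddCommGroup N] [Module R N] {n : ℕ} (f : M →ₗ[R] N) (u : ⋀[R]^n M) :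
    (exteriorPower.map n f u : ExteriorAlgebra R N) = ExteriorAlgebra.map f u := by
  suffices h : (⋀[R]^n N).subtype ∘ₗ exteriorPower.map n f =
      (ExteriorAlgebra.map f).toLinearMap ∘ₗ (⋀[R]^n M).subtype from LinearMap.congr_fun h u
  refine exteriorPower.linearMap_ext (AlternatingMap.ext fun v => ?_)
  simp [Function.comp_def]

lemma isUnit_det_restrict {R M : Type*} [CommRing R] [AddCommGroup M] [Module R M]
    {L : Submodule R M} [Module.Free R L] [Module.Finite R L] {T : M →ₗ[R] M}
    (hTL : ∀ x ∈ L, T x ∈ L) (hLT : L ≤ L.map T) : IsUnit (LinearMap.det (T.restrict hTL)) := by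
  rw [← LinearMap.isUnit_iff_isUnit_det, Module.End.isUnit_iff]
  refine OrzechProperty.bijective_of_surjective_endomorphism _ fun ⟨y, hy⟩ => ?_
  obtain ⟨x, hx, rfl⟩ := hLT hy
  exact ⟨⟨x, hx⟩, rfl⟩

section RestrictScalars

variable {R S M ι : Type*} [CommRing R] [CommRing S] [Algebra R S]
  [Module.IsTorsionFree R S] [AddCommGroup M] [Module R M] [Module S M] [IsScalarTower R S M]
  (b : Module.Basis ι S M)

lemma exists_extend_form_of_span [IsDomain R] [Nontrivial S]
    (χ : Module.Dual R (Submodule.span R (Set.range b))) :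
    ∃ ψ : Module.Dual S M, ∀ x : Submodule.span R (Set.range b), ψ x = algebraMap R S (χ x) := by
  refine ⟨b.constr S fun i => algebraMap R S (χ (b.restrictScalars R i)), fun x => ?_⟩
  suffices h : (b.constr S fun i => algebraMap R S (χ (b.restrictScalars R i))).restrictScalars R ∘ₗ
      (Submodule.span R (Set.range b)).subtype = Algebra.linearMap R S ∘ₗ χ from
    LinearMap.congr_fun h x
  refine (b.restrictScalars R).ext fun i => ?_
  simp only [LinearMap.comp_apply, Submodule.subtype_apply, Module.Basis.restrictScalars_apply,
    LinearMap.restrictScalars_apply, Module.Basis.constr_basis, Algebra.linearMap_apply]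

variable [Finite ι] {T : M →ₗ[S] M}
  (hT : ∀ x ∈ Submodule.span R (Set.range b),
    T.restrictScalars R x ∈ Submodule.span R (Set.range b))
include hT

lemma det_eq_algebraMap_det_restrict [IsDomain R] [Nontrivial S] :
    LinearMap.det T = algebraMap R S (LinearMap.det ((T.restrictScalars R).restrict hT)) := by
  classical
  have := Fintype.ofFinite ι
  rw [← LinearMap.det_toMatrix b, ← LinearMap.det_toMatrix (b.restrictScalars R),
    RingHom.map_det]
  congr 1
  ext i j
  rw [RingHom.mapMatrix_apply, Matrix.map_apply, LinearMap.toMatrix_apply, LinearMap.toMatrix_apply,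
    Module.Basis.restrictScalars_repr_apply, LinearMap.coe_restrict_apply,
    LinearMap.restrictScalars_apply, Module.Basis.restrictScalars_apply]

lemma exists_fixed_integral_form [IsDomain R] [IsDomain S] {v : M} (hv : v ≠ 0) (hTv : T v = v) :
    ∃ χ : Module.Dual S M, χ ≠ 0 ∧ χ ∘ₗ T = χ ∧
      ∀ x ∈ Submodule.span R (Set.range b), ∃ r, χ x = algebraMap R S r := by
  have := Module.Free.of_basis (b.restrictScalars R)
  have := Module.Finite.of_basis (b.restrictScalars R)
  have := Module.Free.of_basis b
  have := Module.Finite.of_basis b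
  have hinj := FaithfulSMul.algebraMap_injective R S
  have hT' : ∀ x ∈ Submodule.span R (Set.range b),
      (T - LinearMap.id).restrictScalars R x ∈ Submodule.span R (Set.range b) := fun x hx => by
    rw [LinearMap.restrictScalars_apply, LinearMap.sub_apply, LinearMap.id_apply]
    exact sub_mem (hT x hx) hx
  have hdet := (exists_fixed_ne_zero_iff_det T).1 ⟨v, hv, hTv⟩
  rw [det_eq_algebraMap_det_restrict b hT', map_eq_zero_iff _ hinj] at hdet
  obtain ⟨χ, hχ, hχT⟩ := (exists_fixed_ne_zero_iff_exists_fixed_form _).1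
    ((exists_fixed_ne_zero_iff_det ((T.restrictScalars R).restrict hT)).2 hdet)
  obtain ⟨ψ, hψ⟩ := exists_extend_form_of_span b χ
  refine ⟨ψ, fun h => hχ (LinearMap.ext fun x => hinj ?_), b.ext fun i => ?_,
    fun x hx => ⟨χ ⟨x, hx⟩, hψ ⟨x, hx⟩⟩⟩
  · rw [← hψ, h, LinearMap.zero_apply, LinearMap.zero_apply, map_zero]
  · have hi := Submodule.subset_span (R := R) (Set.mem_range_self (f := b) i)
    calc ψ (T (b i)) = algebraMap R S (χ ((T.restrictScalars R).restrict hT ⟨b i, hi⟩)) :=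
          hψ ((T.restrictScalars R).restrict hT ⟨b i, hi⟩)
      _ = algebraMap R S (χ ⟨b i, hi⟩) := congrArg _ (LinearMap.congr_fun hχT _)
      _ = ψ (b i) := (hψ ⟨b i, hi⟩).symm

end RestrictScalars

section Lattice

variable {E : Type*} [NormedAddCommGroup E] [NormedSpace ℝ E] [FiniteDimensional ℝ E]

lemma exists_norm_sub_le_of_mem_span (L : Submodule ℤ E) :
    ∃ R, ∀ z ∈ Submodule.span ℝ (L : Set E), ∃ s ∈ L, ‖z - s‖ ≤ R := by
  obtain ⟨t, htL, ht⟩ := Submodule.fg_span_iff_fg_span_finset_subset _ |>.1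
    (IsNoetherian.noetherian (Submodule.span ℝ (L : Set E)))
  refine ⟨∑ x ∈ t, ‖x‖, fun z hz => ?_⟩
  rw [ht] at hz
  obtain ⟨c, -, rfl⟩ := Submodule.mem_span_finset.1 hz
  refine ⟨∑ x ∈ t, ⌊c x⌋ • x, sum_mem fun x hx => zsmul_mem (htL hx) _, ?_⟩
  rw [← Finset.sum_sub_distrib]
  refine norm_sum_le_of_le t fun x _ => ?_
  rw [← Int.cast_smul_eq_zsmul ℝ, ← sub_smul, Int.self_sub_floor, norm_smul, Real.norm_eq_abs,
    Int.abs_fract]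
  exact mul_le_of_le_one_left (norm_nonneg x) (Int.fract_lt_one _).le

lemma exists_basis_span_int_eq {F : Type*} [AddCommGroup F] [Module ℝ F] {f : F →ₗ[ℝ] E}
    (hf : Function.Injective f) {L : Submodule ℤ F} (hL : Submodule.span ℝ (L : Set F) = ⊤)
    (hfin : {x | x ∈ L ∧ ‖f x‖ < 1}.Finite) :
    ∃ (n : ℕ) (b : Module.Basis (Fin n) ℝ F), Submodule.span ℤ (Set.range b) = L := by
  let : NormedAddCommGroup F := NormedAddCommGroup.induced F E f hf
  let : NormedSpace ℝ F := NormedSpace.induced ℝ F E f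
  have : FiniteDimensional ℝ F := Module.Finite.of_injective f hf
  have : DiscreteTopology L := by
    refine discreteTopology_of_isOpen_singleton_zero
      (isOpen_singleton_of_finite_mem_nhds 0 (Metric.ball_mem_nhds 0 one_pos) ?_)
    refine Set.Finite.of_finite_image (hfin.subset ?_) Subtype.val_injective.injOn
    rintro _ ⟨x, hx, rfl⟩
    exact ⟨x.2, (mem_ball_zero_iff (E := F)).1 hx⟩
  have : IsZLattice ℝ L := ⟨hL⟩
  have := ZLattice.module_free ℝ L
  have := ZLattice.module_finite ℝ L
  let b := Module.finBasis ℤ L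
  exact ⟨_, b.ofZLatticeBasis ℝ L, b.ofZLatticeBasis_span ℝ⟩

end Lattice

lemma eq_of_preErgodic_of_forall_le_fixed {X : Type*} [TopologicalSpace X] [MeasurableSpace X]
    [BorelSpace X] {μ : Measure X} [μ.IsOpenPosMeasure] {f : X → X} (herg : PreErgodic f μ)
    (hf : Continuous f) {g : X → ℝ} (hg : Continuous g) {k : ℕ} (hk : k ≠ 0)
    (hgk : ∀ x, g (f^[k] x) = g x) {x₀ : X} (hx₀ : f x₀ = x₀) (hmax : ∀ x, g x ≤ g x₀) (x : X) :
    g x = g x₀ := by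
  have hcont : Continuous (birkhoffSum f g k) :=
    continuous_finsetSum _ fun i _ => hg.comp (hf.iterate i)
  have hinv : birkhoffSum f g k ∘ f = birkhoffSum f g k := funext fun y => by
    rw [Function.comp_apply, ← sub_eq_zero, birkhoffSum_apply_sub_birkhoffSum, hgk, sub_self]
  obtain ⟨c, hc⟩ := herg.ae_eq_const_of_ae_eq_comp hcont.measurable hinv
  have hconst : birkhoffSum f g k = Function.const X c :=
    (hcont.ae_eq_iff_eq μ continuous_const).1 hc
  have hsum : ∑ i ∈ Finset.range k, g (f^[i] x) = ∑ _i ∈ Finset.range k, g x₀ := by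
    calc birkhoffSum f g k x = birkhoffSum f g k x₀ := by rw [hconst]; rfl
      _ = ∑ _i ∈ Finset.range k, g x₀ :=
        Finset.sum_congr rfl fun _ _ => by rw [Function.iterate_fixed hx₀]
  exact (Finset.sum_eq_sum_iff_of_le fun _ _ => hmax _).1 hsum 0
    (Finset.mem_range.2 hk.bot_lt)

lemma isOpenPosMeasure_of_smulInvariantMeasure {G X : Type*} [Group G] [TopologicalSpace X]
    [MulAction G X] [ContinuousConstSMul G X] [MulAction.IsMinimal G X] [CompactSpace X]
    [MeasurableSpace X] (μ : Measure X) [NeZero μ] [SMulInvariantMeasure G X μ] :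
    μ.IsOpenPosMeasure where
  open_pos _ hU hne := (measure_isOpen_pos_of_smulInvariant_of_compact_ne_zero G
    isCompact_univ (NeZero.ne _) hU hne).ne'

lemma nonpos_of_forall_le_mul_pow_mul {C r t : ℝ} (hr0 : 0 ≤ r) (hr1 : r < 1) {k : ℕ} (hk : k ≠ 0)
    (h : ∀ n, t ≤ C * r ^ (k * n) * t) : t ≤ 0 := by
  have hlim := (tendsto_pow_atTop_nhds_zero_of_lt_one (pow_nonneg hr0 k)
    (pow_lt_one₀ hr0 hr1 hk)).const_mul C |>.mul_const t
  simp only [mul_zero, zero_mul, ← pow_mul] at hlim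
  exact ge_of_tendsto' hlim h

lemma fixed_of_isCompl {R E : Type*} [Ring R] [AddCommGroup E] [Module R E] {T : E →ₗ[R] E}
    {S U : Submodule R E} (hSU : IsCompl S U) (hS : ∀ s ∈ S, T s ∈ S) (hU : ∀ u ∈ U, T u ∈ U)
    {s u : E} (hs : s ∈ S) (hu : u ∈ U) (h : T (s + u) = s + u) : T s = s ∧ T u = u := by
  have hsu : T s - s = u - T u := by rw [sub_eq_sub_iff_add_eq_add, ← map_add, h, add_comm]
  have hs0 : T s - s = 0 := Submodule.disjoint_def.1 hSU.disjoint _ (S.sub_mem (hS s hs) hs)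
    (hsu ▸ U.sub_mem hu (hU u hu))
  exact ⟨sub_eq_zero.1 hs0, (sub_eq_zero.1 (hsu ▸ hs0)).symm⟩

lemma eq_zero_of_pow_apply_eq_of_expansion {R E : Type*} [Ring R] [AddCommGroup E] [Module R E]
    {D : E →ₗ[R] E} {S U : Submodule R E} (hSU : IsCompl S U) (hS : ∀ s ∈ S, D s ∈ S)
    (hU : ∀ u ∈ U, D u ∈ U) {q : E → ℝ} (hq : ∀ v, q v ≤ 0 → v = 0) {C r : ℝ} (hr0 : 0 ≤ r)
    (hr1 : r < 1) (hSq : ∀ s ∈ S, ∀ n, q ((D ^ n) s) ≤ C * r ^ n * q s)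
    (hUq : ∀ u ∈ U, ∀ n, q u ≤ C * r ^ n * q ((D ^ n) u)) {k : ℕ} (hk : k ≠ 0) {v : E}
    (hv : (D ^ k) v = v) : v = 0 := by
  obtain ⟨s, hs, u, hu, rfl⟩ := Submodule.mem_sup.1 (hSU.sup_eq_top ▸ Submodule.mem_top (x := v))
  obtain ⟨hDs, hDu⟩ := fixed_of_isCompl hSU
    (fun x hx => Module.End.pow_apply D k x ▸ Set.MapsTo.iterate hS k hx)
    (fun x hx => Module.End.pow_apply D k x ▸ Set.MapsTo.iterate hU k hx) hs hu hv
  have hpow : ∀ {x}, (D ^ k) x = x → ∀ n, (D ^ (k * n)) x = x := fun hx n => by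
    rw [pow_mul, Module.End.pow_apply]
    exact Function.iterate_fixed hx n
  have hs0 : s = 0 := hq s <| nonpos_of_forall_le_mul_pow_mul hr0 hr1 hk fun n => by
    simpa only [hpow hDs n] using hSq s hs (k * n)
  have hu0 : u = 0 := hq u <| nonpos_of_forall_le_mul_pow_mul hr0 hr1 hk fun n => by
    simpa only [hpow hDu n] using hUq u hu (k * n)
  rw [hs0, hu0, add_zero]

section Manifold

variable {𝕜 : Type*} [NontriviallyNormedField 𝕜]
  {E : Type*} [NormedAddCommGroup E] [NormedSpace 𝕜 E] {H : Type*} [TopologicalSpace H]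
  {I : ModelWithCorners 𝕜 E H} {M : Type*} [TopologicalSpace M] [ChartedSpace H M]

lemma hasMFDerivAt_comp_of_eq {E' : Type*} [NormedAddCommGroup E'] [NormedSpace 𝕜 E']
    {H' : Type*} [TopologicalSpace H'] {I' : ModelWithCorners 𝕜 E' H'} {M' : Type*}
    [TopologicalSpace M'] [ChartedSpace H' M'] {E'' : Type*} [NormedAddCommGroup E'']
    [NormedSpace 𝕜 E''] {H'' : Type*} [TopologicalSpace H''] {I'' : ModelWithCorners 𝕜 E'' H''}
    {M'' : Type*} [TopologicalSpace M''] [ChartedSpace H'' M''] {f : M → M'} {g : M' → M''} {x : M}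
    {y : M'} {A : E →L[𝕜] E'} {B : E' →L[𝕜] E''} (hg : HasMFDerivAt I' I'' g y B)
    (hf : HasMFDerivAt I I' f x A) (hxy : f x = y) : HasMFDerivAt I I'' (g ∘ f) x (B.comp A) := by
  subst hxy
  exact hg.comp x hf

lemma hasMFDerivAt_iterate {f : M → M} {x : M} {D : E →L[𝕜] E} (hD : HasMFDerivAt I I f x D)
    (hx : f x = x) (n : ℕ) : HasMFDerivAt I I f^[n] x (D ^ n : E →L[𝕜] E) := by
  induction n with
  | zero => exact hasMFDerivAt_id x
  | succ n ih => exact pow_succ D n ▸ hasMFDerivAt_comp_of_eq ih hD hx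

end Manifold

theorem IsAnosovDiffeomorph.eq_zero_of_hasMFDerivAt_of_pow_apply_eq {E : Type*}
    [NormedAddCommGroup E] [NormedSpace ℝ E] {H : Type*} [TopologicalSpace H]
    {I : ModelWithCorners ℝ E H} {M : Type*} [TopologicalSpace M] [ChartedSpace H M]
    [IsManifold I 1 M] {f : M → M} (hf : IsAnosovDiffeomorph I f) {x : M} (hx : f x = x)
    {D : E →L[ℝ] E} (hD : HasMFDerivAt I I f x D) {k : ℕ} (hk : k ≠ 0) {v : E}
    (hv : (D ^ k) v = v) : v = 0 := by
  obtain ⟨-, g, Es, Eu, C, r, -, hr0, hr1, hsplit⟩ := hf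
  obtain ⟨hcompl, hs, hu, hsn, hun⟩ := hsplit x
  -- Every `TangentSpace I y` is by definition `E`, so the data at `y` can be compared with those
  -- at `x` once `y = x`.
  have hfib : ∀ y, y = x → (∀ a : E, g.inner y a a = g.inner x a a) ∧
      (∀ a : E, a ∈ Es y → a ∈ Es x) ∧ ∀ a : E, a ∈ Eu y → a ∈ Eu x := by
    rintro _ rfl
    exact ⟨fun _ => rfl, fun _ => id, fun _ => id⟩
  have hfix : ∀ n, f^[n] x = x := Function.iterate_fixed hx
  have hDn : ∀ n (a : E), @Eq E (mfderiv I I f^[n] x a) (((D : E →ₗ[ℝ] E) ^ n) a) := fun n a => by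
    rw [(hasMFDerivAt_iterate hD hx n).mfderiv, ← ContinuousLinearMap.toLinearMap_pow]
    rfl
  have hnorm : ∀ n (a : E), √(g.inner (f^[n] x) (mfderiv I I f^[n] x a) (mfderiv I I f^[n] x a)) =
      √(g.inner x (((D : E →ₗ[ℝ] E) ^ n) a) (((D : E →ₗ[ℝ] E) ^ n) a)) := fun n a =>
    congrArg Real.sqrt (((hfib _ (hfix n)).1 _).trans
      (congrArg (fun b : E => g.inner x b b) (hDn n a)))
  rw [hD.mfderiv] at hs hu
  refine eq_zero_of_pow_apply_eq_of_expansion (D := (D : E →ₗ[ℝ] E)) (S := Es x) (U := Eu x)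
    (q := fun a : E => √(g.inner x a a)) (C := C) hcompl
    (fun a ha => (hfib _ hx).2.1 _ (hs.le ⟨a, ha, rfl⟩))
    (fun a ha => (hfib _ hx).2.2 _ (hu.le ⟨a, ha, rfl⟩)) (fun a ha => ?_) hr0.le hr1
    (fun a ha n => (hnorm n a).symm.le.trans (hsn a ha n))
    (fun a ha n => (hun a ha n).trans_eq (congrArg _ (hnorm n a))) hk ?_
  · by_contra hne
    exact (Real.sqrt_pos.2 (g.pos x a hne)).not_ge ha
  · rw [← ContinuousLinearMap.toLinearMap_pow]
    exact hv

namespace TwoStep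

section Wedge

variable {V : Type} [AddCommGroup V] [Module ℝ V]

lemma coe_wedge (v w : V) : (wedge v w : ExteriorAlgebra ℝ V) = .ι ℝ v * .ι ℝ w := by
  rw [wedge_apply, exteriorPower.ιMulti_apply_coe, ExteriorAlgebra.ιMulti_apply]
  simp

lemma wedge_mul_wedge_eq_ιMulti (a b c d : V) :
    (wedge a b * wedge c d : ExteriorAlgebra ℝ V) = ExteriorAlgebra.ιMulti ℝ 4 ![a, b, c, d] := by
  simp [coe_wedge, ExteriorAlgebra.ιMulti_apply, mul_assoc]

lemma wedge_mul_wedge_eq_zero (a b c d : V) (h : a = c ∨ a = d ∨ b = c ∨ b = d) :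
    (wedge a b * wedge c d : ExteriorAlgebra ℝ V) = 0 := by
  rw [wedge_mul_wedge_eq_ιMulti]
  rcases h with rfl | rfl | rfl | rfl
  · exact AlternatingMap.map_eq_zero_of_eq _ _ (i := 0) (j := 2) rfl (by decide)
  · exact AlternatingMap.map_eq_zero_of_eq _ _ (i := 0) (j := 3) rfl (by decide)
  · exact AlternatingMap.map_eq_zero_of_eq _ _ (i := 1) (j := 2) rfl (by decide)
  · exact AlternatingMap.map_eq_zero_of_eq _ _ (i := 1) (j := 3) rfl (by decide)

lemma volumeForm_wedge_mul_wedge_mul_ι (b₀ : Module.Basis (Fin 5) ℝ V) (a b c d v : V) :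
    volumeForm b₀ (wedge a b * wedge c d * .ι ℝ v) =
      Matrix.det (Matrix.of ![b₀.equivFun a, b₀.equivFun b, b₀.equivFun c, b₀.equivFun d,
        b₀.equivFun v]) := by
  rw [wedge_mul_wedge_eq_ιMulti, ← Matrix.det_transpose]
  trans volumeForm b₀ (ExteriorAlgebra.ιMulti ℝ 5 ![a, b, c, d, v])
  · simp [ExteriorAlgebra.ιMulti_apply, mul_assoc]
  rw [volumeForm_ιMulti, Module.Basis.det_apply]
  congr! 2
  ext i j
  fin_cases j <;> rfl

lemma wedge_hom_ext {N : Type*} [AddCommGroup N] [Module ℝ N] {f g : ⋀[ℝ]^2 V →ₗ[ℝ] N}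
    (h : ∀ v w, f (wedge v w) = g (wedge v w)) : f = g := by
  refine exteriorPower.linearMap_ext (AlternatingMap.ext fun v => ?_)
  have hv : v = ![v 0, v 1] := by ext i; fin_cases i <;> rfl
  rw [hv]
  exact h (v 0) (v 1)

lemma map_wedge {V' : Type} [AddCommGroup V'] [Module ℝ V'] (f : V →ₗ[ℝ] V') (v w : V) :
    exteriorPower.map 2 f (wedge v w) = wedge (f v) (f w) := by
  rw [wedge_apply, wedge_apply, exteriorPower.map_apply_ιMulti]
  congr 1
  ext i
  fin_cases i <;> rfl

end Wedge

/-- The basis `σ₁, …, σ₅` of `V`. -/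
def sigmaBasis : Module.Basis (Fin 5) ℝ V := .ofEquivFun
  { toFun v := ![v.1 0 0 / 2, v.1 0 1, v.1 0 2, v.1 1 2, v.1 2 2 / 2]
    map_add' v w := by
      funext i
      fin_cases i <;> simp [add_div]
    map_smul' c v := by
      funext i
      fin_cases i <;> simp [mul_div_assoc]
    invFun c := c 0 • σ₁ + c 1 • σ₂ + c 2 • σ₃ + c 3 • σ₄ + c 4 • σ₅
    left_inv v := by
      obtain ⟨v, hsymm, htr⟩ := v
      ext i j
      fin_cases i <;> fin_cases j <;>
        simp [σ₁, σ₂, σ₃, σ₄, σ₅, hsymm.apply 0 1, hsymm.apply 0 2, hsymm.apply 1 2, htr, mul_two]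
    right_inv c := by
      funext i
      fin_cases i <;> simp [σ₁, σ₂, σ₃, σ₄, σ₅] }

lemma sigmaBasis_equivFun (v : V) :
    sigmaBasis.equivFun v = ![v.1 0 0 / 2, v.1 0 1, v.1 0 2, v.1 1 2, v.1 2 2 / 2] := by
  simp [sigmaBasis]

lemma sigmaBasis_equivFun_σ : sigmaBasis.equivFun σ₁ = ![1, 0, 0, 0, 0] ∧
    sigmaBasis.equivFun σ₂ = ![0, 1, 0, 0, 0] ∧ sigmaBasis.equivFun σ₃ = ![0, 0, 1, 0, 0] ∧
    sigmaBasis.equivFun σ₄ = ![0, 0, 0, 1, 0] ∧ sigmaBasis.equivFun σ₅ = ![0, 0, 0, 0, 1] := by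
  simp [sigmaBasis_equivFun, σ₁, σ₂, σ₃, σ₄, σ₅, -Module.Basis.equivFun_apply]

/-- Generators of `W`, with signs and order chosen so that `pencil i ∧ pencil j ∧ v` is
`-vᵢⱼ • σ₁ ∧ σ₂ ∧ σ₃ ∧ σ₄ ∧ σ₅` for every `v ∈ V`. -/
def pencil : Fin 3 → ⋀[ℝ]^2 V :=
  ![wedge σ₂ σ₅ - wedge σ₃ σ₄, wedge σ₂ σ₄ - wedge σ₁ σ₅, wedge σ₁ σ₄ - wedge σ₂ σ₃]

theorem volumeForm_pencil (v : V) (i j : Fin 3) :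
    volumeForm sigmaBasis (pencil i * pencil j * .ι ℝ v) = -v.1 i j := by
  obtain ⟨h₁, h₂, h₃, h₄, h₅⟩ := sigmaBasis_equivFun_σ
  obtain ⟨v, hsymm, htr⟩ := v
  rw [pencil]
  fin_cases i <;> fin_cases j <;>
    simp [mul_sub, sub_mul, wedge_mul_wedge_eq_zero, volumeForm_wedge_mul_wedge_mul_ι, h₁, h₂, h₃,
      h₄, h₅, sigmaBasis_equivFun, -Module.Basis.equivFun_apply, det_succ_row_zero,
      Fin.sum_univ_five, Fin.sum_univ_four, Fin.sum_univ_three, Fin.succAbove, htr,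
      hsymm.apply 0 1, hsymm.apply 0 2, hsymm.apply 1 2] <;>
    ring

lemma span_range_pencil : Submodule.span ℝ (Set.range pencil) = W := by
  refine le_antisymm (Submodule.span_le.2 ?_) (Submodule.span_le.2 ?_)
  · rintro _ ⟨i, rfl⟩
    fin_cases i
    · exact Submodule.subset_span (.inr (.inr rfl))
    · change wedge σ₂ σ₄ - wedge σ₁ σ₅ ∈ W
      exact (sub_mem_comm_iff).1 (Submodule.subset_span (.inr (.inl rfl)))
    · exact Submodule.subset_span (.inl rfl)
  · rintro _ (rfl | rfl | rfl)
    · exact Submodule.subset_span ⟨2, rfl⟩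
    · exact neg_sub (wedge σ₂ σ₄) _ ▸ neg_mem (Submodule.subset_span ⟨1, rfl⟩)
    · exact Submodule.subset_span ⟨0, rfl⟩

theorem transpose_mul_apply_mul_eq_det_smul {A : V →ₗ[ℝ] V} {H : Matrix (Fin 3) (Fin 3) ℝ}
    (hH : ∀ j, exteriorPower.map 2 A (pencil j) = ∑ i, H i j • pencil i) (v : V) :
    Hᵀ * (A v).1 * H = LinearMap.det A • v.1 := by
  ext i j
  have hinv := volumeForm_map sigmaBasis A (pencil i * pencil j * .ι ℝ v)
  rw [map_mul (ExteriorAlgebra.map A), map_mul (ExteriorAlgebra.map A),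
    ExteriorAlgebra.map_apply_ι, ← coe_exteriorPower_map, ← coe_exteriorPower_map, hH, hH,
    volumeForm_pencil] at hinv
  simp only [Submodule.coe_sum, Submodule.coe_smul, Finset.sum_mul, Finset.mul_sum,
    smul_mul_assoc, mul_smul_comm, map_sum, map_smul, volumeForm_pencil, smul_eq_mul,
    mul_neg, Finset.sum_neg_distrib, neg_inj] at hinv
  simp only [Matrix.smul_apply, smul_eq_mul, ← hinv, Matrix.mul_apply, transpose_apply,
    Finset.sum_mul]
  refine Finset.sum_congr rfl fun k _ => Finset.sum_congr rfl fun l _ => ?_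
  ring

/-- The matrix of the conic apolar to `V`: it spans, among symmetric matrices, the orthogonal of `V`
for the trace pairing. -/
def apolarConic : Matrix (Fin 3) (Fin 3) ℝ := !![0, 0, -1; 0, 1, 0; -1, 0, 0]

lemma trace_apolarConic_mul (v : V) : (apolarConic * v.1).trace = 0 := by
  obtain ⟨v, hsymm, htr⟩ := v
  simp [apolarConic, trace_fin_three, htr, vecMul, dotProduct, Fin.sum_univ_three]

lemma eq_smul_apolarConic_of_trace {S : Matrix (Fin 3) (Fin 3) ℝ} (hS : S.IsSymm)
    (h : ∀ v : V, (S * v.1).trace = 0) : S = S 1 1 • apolarConic := by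
  have h₀₀ : S 0 0 = 0 := by
    simpa [σ₁, trace_fin_three, mul_apply, Fin.sum_univ_three] using h σ₁
  have h₂₂ : S 2 2 = 0 := by
    simpa [σ₅, trace_fin_three, mul_apply, Fin.sum_univ_three] using h σ₅
  have h₀₁ : S 0 1 + S 1 0 = 0 := by
    simpa [σ₂, trace_fin_three, mul_apply, Fin.sum_univ_three] using h σ₂
  have h₁₂ : S 1 2 + S 2 1 = 0 := by
    simpa [σ₄, trace_fin_three, mul_apply, Fin.sum_univ_three] using h σ₄
  have h₀₂ : S 0 2 + S 1 1 * 2 + S 2 0 = 0 := by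
    simpa [σ₃, trace_fin_three, mul_apply, Fin.sum_univ_three] using h σ₃
  have := hS.apply 0 1
  have := hS.apply 0 2
  have := hS.apply 1 2
  ext i j
  fin_cases i <;> fin_cases j <;> simp [apolarConic] <;> linarith

/-- The trace form `(v, w) ↦ tr (q v q w)` on `V`, with `q` the matrix `apolarConic`. -/
def apolarForm : LinearMap.BilinForm ℝ V :=
  ((LinearMap.mul ℝ (Matrix (Fin 3) (Fin 3) ℝ)).compr₂ (traceLinearMap (Fin 3) ℝ ℝ)).compl₁₂
    (LinearMap.mulLeft ℝ apolarConic ∘ₗ V.subtype) (LinearMap.mulLeft ℝ apolarConic ∘ₗ V.subtype)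

lemma apolarForm_apply (v w : V) :
    apolarForm v w = (apolarConic * v.1 * (apolarConic * w.1)).trace := rfl

lemma apolarConic_mul_self : apolarConic * apolarConic = 1 := by
  ext i j
  fin_cases i <;> fin_cases j <;> simp [apolarConic]

lemma isSymm_apolarConic : apolarConic.IsSymm := by
  ext i j
  fin_cases i <;> fin_cases j <;> simp [apolarConic]

lemma det_apolarConic_ne_zero : apolarConic.det ≠ 0 := fun h => by
  simpa [h] using congrArg det apolarConic_mul_self

lemma nondegenerate_apolarForm : apolarForm.Nondegenerate := by
  have hsymm : apolarForm.IsSymm := ⟨fun v w => trace_mul_comm (apolarConic * v.1) _⟩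
  refine hsymm.isRefl.nondegenerate_iff_separatingLeft.2 fun v hv => ?_
  set c := (apolarConic * v.1 * apolarConic) 1 1
  have hc : apolarConic * v.1 * apolarConic = c • apolarConic := by
    refine eq_smul_apolarConic_of_trace ?_ fun w => ?_
    · rw [IsSymm, transpose_mul, transpose_mul, isSymm_apolarConic.eq, v.2.1.eq, Matrix.mul_assoc]
    · rw [Matrix.mul_assoc _ apolarConic, ← apolarForm_apply, hv]
  have hv : apolarConic * v.1 = c • 1 := by
    have h := congrArg (· * apolarConic) hc
    simpa only [Matrix.mul_assoc, apolarConic_mul_self, mul_one, smul_mul] using h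
  have hc0 : c = 0 := by simpa [hv] using trace_apolarConic_mul v
  ext : 1
  simpa [hc0, ← Matrix.mul_assoc, apolarConic_mul_self] using congrArg (apolarConic * ·) hv

lemma exists_mul_apolarConic_mul_transpose_eq_smul {A : V →ₗ[ℝ] V} (hA : Function.Surjective A)
    {H : Matrix (Fin 3) (Fin 3) ℝ} (hH : ∀ v, Hᵀ * (A v).1 * H = v.1) :
    ∃ c : ℝ, H * apolarConic * Hᵀ = c • apolarConic := by
  refine ⟨_, eq_smul_apolarConic_of_trace ?_ fun w => ?_⟩
  · rw [IsSymm, transpose_mul, transpose_mul, transpose_transpose, isSymm_apolarConic.eq,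
      Matrix.mul_assoc]
  · obtain ⟨v, rfl⟩ := hA w
    rw [Matrix.mul_assoc, Matrix.mul_assoc, trace_mul_comm, Matrix.mul_assoc, hH,
      trace_apolarConic_mul]

lemma sq_smul_apolarForm_comp {A : V →ₗ[ℝ] V} {H : Matrix (Fin 3) (Fin 3) ℝ} {c : ℝ}
    (hH : ∀ v, Hᵀ * (A v).1 * H = v.1) (hc : H * apolarConic * Hᵀ = c • apolarConic) :
    c ^ 2 • apolarForm.comp A A = apolarForm := by
  ext v w
  calc c ^ 2 * apolarForm (A v) (A w)
      = (H * apolarConic * Hᵀ * (A v).1 * (H * apolarConic * Hᵀ * (A w).1)).trace := by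
        simp only [hc, apolarForm_apply, smul_mul, Matrix.mul_smul, trace_smul, smul_eq_mul]
        ring
    _ = (H * (apolarConic * Hᵀ * (A v).1 * (H * apolarConic * Hᵀ * (A w).1))).trace := by
        simp only [Matrix.mul_assoc]
    _ = (apolarConic * (Hᵀ * (A v).1 * H) * (apolarConic * (Hᵀ * (A w).1 * H))).trace := by
        rw [trace_mul_comm]
        simp only [Matrix.mul_assoc]
    _ = apolarForm v w := by rw [hH, hH, apolarForm_apply]

theorem mul_apolarConic_mul_transpose_of_det_eq_one {A : V →ₗ[ℝ] V} (hA : LinearMap.det A = 1)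
    {H : Matrix (Fin 3) (Fin 3) ℝ} (hH : ∀ v, Hᵀ * (A v).1 * H = v.1) :
    H * apolarConic * Hᵀ = apolarConic := by
  have hunit : IsUnit A := (LinearMap.isUnit_iff_isUnit_det A).2 (hA ▸ isUnit_one)
  obtain ⟨c, hc⟩ :=
    exists_mul_apolarConic_mul_transpose_eq_smul ((Module.End.isUnit_iff A).1 hunit).2 hH
  have hpow : (c ^ 2) ^ 5 = 1 := by
    have h := pow_finrank_mul_det_sq_eq_one nondegenerate_apolarForm (sq_smul_apolarForm_comp hH hc)
    rwa [hA, one_pow, mul_one, Module.finrank_eq_card_basis sigmaBasis, Fintype.card_fin] at h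
  have hdet : H.det ^ 2 = c ^ 3 := by
    have h := congrArg det hc
    rw [det_mul, det_mul, det_transpose, det_smul, Fintype.card_fin] at h
    exact mul_right_cancel₀ det_apolarConic_ne_zero (by linear_combination h)
  have hc0 : 0 ≤ c := (Odd.pow_nonneg_iff (n := 3) (by decide)).1 (hdet ▸ sq_nonneg _)
  have hc1 : c = 1 := by
    rw [← pow_mul] at hpow
    exact (pow_eq_one_iff_of_nonneg hc0 (by norm_num)).1 hpow
  rw [hc, hc1, one_smul]

/-- The value at `x` of the quadratic form with matrix `v`, as a linear form in `v`. -/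
def quadraticEval (x : Fin 3 → ℝ) : Module.Dual ℝ V where
  toFun v := x ⬝ᵥ v.1 *ᵥ x
  map_add' v w := by rw [Submodule.coe_add, add_mulVec, dotProduct_add]
  map_smul' c v := by
    rw [Submodule.coe_smul, smul_mulVec, dotProduct_smul, RingHom.id_apply]

lemma quadraticEval_apply (x : Fin 3 → ℝ) (v : V) : quadraticEval x v = x ⬝ᵥ v.1 *ᵥ x := rfl

lemma quadraticEval_ne_zero {x : Fin 3 → ℝ} (hx : x ≠ 0) : quadraticEval x ≠ 0 := by
  intro h
  have h₀ : x 0 = 0 := by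
    simpa [quadraticEval_apply, σ₁, dotProduct, Fin.sum_univ_three] using LinearMap.congr_fun h σ₁
  have h₂ : x 2 = 0 := by
    simpa [quadraticEval_apply, σ₅, dotProduct, Fin.sum_univ_three] using LinearMap.congr_fun h σ₅
  have h₁ : x 1 = 0 := by
    simpa [quadraticEval_apply, σ₃, dotProduct, Fin.sum_univ_three, h₀, h₂] using
      LinearMap.congr_fun h σ₃
  refine hx (funext fun i => ?_)
  fin_cases i
  exacts [h₀, h₁, h₂]

lemma exists_fixed_form_of_transpose_mul_apply_mul {A : V →ₗ[ℝ] V} {H : Matrix (Fin 3) (Fin 3) ℝ}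
    (hH : ∀ v, Hᵀ * (A v).1 * H = v.1) (hq : H * apolarConic * Hᵀ = apolarConic) :
    ∃ χ : Module.Dual ℝ V, χ ≠ 0 ∧ χ ∘ₗ A = χ := by
  obtain ⟨x, hx0, hx⟩ := exists_mulVec_eq_zero_iff.2
    (det_sub_det_smul_one_eq_zero (by decide) det_apolarConic_ne_zero hq)
  have hHx : H *ᵥ x = H.det • x := by
    rwa [sub_mulVec, smul_mulVec, one_mulVec, sub_eq_zero] at hx
  have hdet := det_mul_self_eq_one_of_mul_mul_transpose det_apolarConic_ne_zero hq
  refine ⟨quadraticEval x, quadraticEval_ne_zero hx0, LinearMap.ext fun v => ?_⟩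
  calc x ⬝ᵥ (A v).1 *ᵥ x = (H *ᵥ x) ⬝ᵥ (A v).1 *ᵥ (H *ᵥ x) := by
        rw [hHx, mulVec_smul, dotProduct_smul, smul_dotProduct, smul_smul, hdet, one_smul]
    _ = x ⬝ᵥ (Hᵀ * (A v).1 * H) *ᵥ x := by
        rw [← mulVec_mulVec, ← mulVec_mulVec, dotProduct_mulVec x, vecMul_transpose]
    _ = x ⬝ᵥ v.1 *ᵥ x := by rw [hH]

theorem exists_fixed_vector_of_det_eq_one {A : V →ₗ[ℝ] V} (hA : LinearMap.det A = 1)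
    (hW : ∀ u ∈ W, exteriorPower.map 2 A u ∈ W) : ∃ v : V, v ≠ 0 ∧ A v = v := by
  have hpencil : ∀ j, ∃ h : Fin 3 → ℝ, ∑ i, h i • pencil i = exteriorPower.map 2 A (pencil j) :=
    fun j => (Submodule.mem_span_range_iff_exists_fun ℝ).1 <| span_range_pencil ▸
      hW _ (span_range_pencil ▸ Submodule.subset_span ⟨j, rfl⟩)
  choose h hh using hpencil
  have hH : ∀ v, (of h)ᵀᵀ * (A v).1 * (of h)ᵀ = v.1 := fun v => by
    rw [transpose_mul_apply_mul_eq_det_smul (H := (of h)ᵀ) (fun j => (hh j).symm), hA, one_smul]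
  have hq := mul_apolarConic_mul_transpose_of_det_eq_one hA hH
  exact (exists_fixed_ne_zero_iff_exists_fixed_form A).2
    (exists_fixed_form_of_transpose_mul_apply_mul hH hq)

section LieMap

variable {V : Type} [AddCommGroup V] [Module ℝ V] {W : Submodule ℝ (⋀[ℝ]^2 V)}

/-- The projection of the Lie algebra onto its abelianization `V`. -/
def abelianize (W : Submodule ℝ (⋀[ℝ]^2 V)) : LieAlg W →ₗ[ℝ] V :=
  LinearMap.fst ℝ V ((⋀[ℝ]^2 V) ⧸ W)

lemma abelianize_surjective : Function.Surjective (abelianize W) := Prod.fst_surjective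

/-- The map `⋀² V → LieAlg W` sending `v ∧ w` to the bracket of any two lifts of `v` and `w`. -/
def ofWedge (W : Submodule ℝ (⋀[ℝ]^2 V)) : ⋀[ℝ]^2 V →ₗ[ℝ] LieAlg W :=
  LinearMap.inr ℝ V ((⋀[ℝ]^2 V) ⧸ W) ∘ₗ W.mkQ

lemma ofWedge_wedge (X Y : LieAlg W) :
    ofWedge W (wedge (abelianize W X) (abelianize W Y)) = ⁅X, Y⁆ := rfl

lemma ofWedge_eq_zero_iff {u : ⋀[ℝ]^2 V} : ofWedge W u = 0 ↔ u ∈ W :=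
  (map_eq_zero_iff _ LinearMap.inr_injective).trans (Submodule.Quotient.mk_eq_zero W)

lemma range_ofWedge : LinearMap.range (ofWedge W) = LinearMap.ker (abelianize W) :=
  (LinearMap.range_comp_of_range_eq_top _ W.range_mkQ).trans (LinearMap.range_inr ..)

lemma log_exp (X : LieAlg W) : log (exp X : NilGroup W) = X := rfl

lemma lie_lie_right (X Y Z : LieAlg W) : ⁅X, ⁅Y, Z⁆⁆ = 0 := bracket_bracket_right W X Y Z

lemma exp_add (X Y : LieAlg W) :
    (exp (X + Y) : NilGroup W) = exp X * exp Y * exp (-(1 / 2 : ℝ) • ⁅X, Y⁆) := by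
  apply log.injective
  rw [log_mul, log_mul, log_exp, log_exp, log_exp, log_exp, lie_smul, lie_lie_right, smul_zero,
    smul_zero]
  module

open scoped commutatorElement in
lemma exp_lie (X Y : LieAlg W) : (exp ⁅X, Y⁆ : NilGroup W) = ⁅exp X, exp Y⁆ :=
  log.injective (log_commutatorElement (exp X) (exp Y)).symm

variable [Module.Finite ℝ V]

lemma log_apply_exp_lie (τ : NilGroup W ≃ₜ* NilGroup W) (X Y : LieAlg W) :
    log (τ (exp ⁅X, Y⁆)) = ⁅log (τ (exp X)), log (τ (exp Y))⁆ := by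
  rw [exp_lie, map_commutatorElement, log_commutatorElement]

/-- The automorphism of the Lie algebra induced by a continuous automorphism of the group: the
automorphism itself, read in exponential coordinates. -/
def lieMap (τ : NilGroup W ≃ₜ* NilGroup W) : LieAlg W →ₗ[ℝ] LieAlg W where
  toFun X := log (τ (exp X))
  map_smul' c X := log_apply_smul τ c X
  map_add' X Y := by
    rw [exp_add, map_mul τ, map_mul τ, log_mul, log_mul, log_apply_smul, log_apply_exp_lie,
      lie_smul, lie_lie_right]
    module

lemma abelianize_lieMap (τ : NilGroup W ≃ₜ* NilGroup W) (X : LieAlg W) :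
    abelianize W (lieMap τ X) = factor τ (abelianize W X) := (factor_proj τ (exp X)).symm

lemma lieMap_ofWedge (τ : NilGroup W ≃ₜ* NilGroup W) (u : ⋀[ℝ]^2 V) :
    lieMap τ (ofWedge W u) = ofWedge W (exteriorPower.map 2 (factor τ) u) := by
  suffices h : lieMap τ ∘ₗ ofWedge W = ofWedge W ∘ₗ exteriorPower.map 2 (factor τ) from
    LinearMap.congr_fun h u
  refine wedge_hom_ext fun v w => ?_
  obtain ⟨X, rfl⟩ := abelianize_surjective (W := W) v
  obtain ⟨Y, rfl⟩ := abelianize_surjective (W := W) w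
  rw [LinearMap.comp_apply, LinearMap.comp_apply, map_wedge, ofWedge_wedge,
    ← abelianize_lieMap, ← abelianize_lieMap, ofWedge_wedge]
  exact log_apply_exp_lie τ X Y

lemma map_factor_mem (τ : NilGroup W ≃ₜ* NilGroup W) {u : ⋀[ℝ]^2 V} (hu : u ∈ W) :
    exteriorPower.map 2 (factor τ) u ∈ W := by
  rw [← ofWedge_eq_zero_iff] at hu ⊢
  rw [← lieMap_ofWedge, hu, map_zero]

lemma map_factor_pow_mem (τ : NilGroup W ≃ₜ* NilGroup W) (k : ℕ) {u : ⋀[ℝ]^2 V} (hu : u ∈ W) :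
    exteriorPower.map 2 (factor τ ^ k) u ∈ W := by
  induction k with
  | zero => rwa [pow_zero, Module.End.one_eq_id, exteriorPower.map_id]
  | succ k ih =>
    rw [pow_succ', Module.End.mul_eq_comp, exteriorPower.map_comp]
    exact map_factor_mem τ ih

end LieMap

theorem exists_fixed_vector_of_det_factor_pow {τ : G ≃ₜ* G} {k : ℕ}
    (hτ : LinearMap.det (factor τ) ^ k = 1) : ∃ v : V, v ≠ 0 ∧ (factor τ ^ k) v = v :=
  exists_fixed_vector_of_det_eq_one (by rwa [map_pow]) fun _ => map_factor_pow_mem τ k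

section Lattice

variable {V : Type} [AddCommGroup V] [Module ℝ V] {W : Submodule ℝ (⋀[ℝ]^2 V)}

lemma map₂_wedge_top : Submodule.map₂ (wedge (V := V)) ⊤ ⊤ = ⊤ := by
  rw [eq_top_iff, ← exteriorPower.ιMulti_span, Submodule.span_le]
  rintro _ ⟨v, rfl⟩
  have hv : v = ![v 0, v 1] := by ext i; fin_cases i <;> rfl
  rw [hv]
  exact Submodule.apply_mem_map₂ _ Submodule.mem_top Submodule.mem_top

variable (Γ : Subgroup (NilGroup W))

/-- The image of `Γ` in the abelianization `V` of the group. -/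
def abelianLattice : Submodule ℤ V :=
  AddSubgroup.toIntSubmodule (Subgroup.toAddSubgroup' (Γ.map (proj W)))

lemma abelianize_log_mul (x y : NilGroup W) :
    abelianize W (log (x * y)) = abelianize W (log x) + abelianize W (log y) :=
  congrArg Multiplicative.toAdd (map_mul (proj W) x y)

lemma lie_eq_zero_of_abelianize_eq_zero {X : LieAlg W} (hX : abelianize W X = 0)
    (Y : LieAlg W) : ⁅X, Y⁆ = 0 := by
  rw [← ofWedge_wedge, hX, map_zero, LinearMap.zero_apply, map_zero]

lemma exp_add_of_abelianize_eq_zero {X : LieAlg W} (hX : abelianize W X = 0)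
    (Y : LieAlg W) : (exp (X + Y) : NilGroup W) = exp X * exp Y := by
  rw [exp_add, lie_eq_zero_of_abelianize_eq_zero hX, smul_zero]
  exact mul_one _

/-- The logarithms of the elements of `Γ` lying in the commutator subgroup of the group. -/
def centralLattice : Submodule ℤ (LieAlg W) :=
  AddSubgroup.toIntSubmodule
    { carrier := {X | abelianize W X = 0 ∧ exp X ∈ Γ}
      zero_mem' := ⟨map_zero _, Γ.one_mem⟩
      add_mem' := fun {X Y} hX hY => ⟨by rw [map_add, hX.1, hY.1, add_zero], by
        rw [exp_add_of_abelianize_eq_zero hX.1]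
        exact Γ.mul_mem hX.2 hY.2⟩
      neg_mem' := fun {X} hX => ⟨by rw [map_neg, hX.1, neg_zero], Γ.inv_mem hX.2⟩ }

variable {Γ}

open scoped commutatorElement in
lemma lie_mem_centralLattice {x y : NilGroup W} (hx : x ∈ Γ) (hy : y ∈ Γ) :
    ⁅log x, log y⁆ ∈ centralLattice Γ := by
  refine ⟨?_, ?_⟩
  · have h : ⁅log x, log y⁆ ∈ LinearMap.range (ofWedge W) := ⟨_, ofWedge_wedge _ _⟩
    rwa [range_ofWedge] at h
  · have h : ⁅x, y⁆ ∈ Γ := commutatorElement_def x y ▸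
      Γ.mul_mem (Γ.mul_mem (Γ.mul_mem hx hy) (Γ.inv_mem hx)) (Γ.inv_mem hy)
    rwa [← log_commutatorElement]

lemma ker_abelianize_le_span_centralLattice
    (hΓ : Submodule.span ℝ (abelianLattice Γ : Set V) = ⊤) :
    LinearMap.ker (abelianize W) ≤ Submodule.span ℝ (centralLattice Γ : Set (LieAlg W)) := by
  rw [← range_ofWedge, LinearMap.range_eq_map, ← map₂_wedge_top, ← hΓ, Submodule.map₂_span_span,
    Submodule.map_span, Submodule.span_le]
  rintro _ ⟨_, ⟨_, ⟨x, hx, rfl⟩, _, ⟨y, hy, rfl⟩, rfl⟩, rfl⟩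
  exact Submodule.subset_span (lie_mem_centralLattice hx hy)

variable [Module.Finite ℝ V]

lemma exists_continuous_descend {X : Type*} [TopologicalSpace X] {φ : V → X}
    (hφ : Continuous fun x : NilGroup W => φ (abelianize W (log x)))
    (hφΓ : ∀ v, ∀ l ∈ abelianLattice Γ, φ (v + l) = φ v) :
    ∃ Φ : NilGroup W ⧸ Γ → X, Continuous Φ ∧
      ∀ x : NilGroup W, Φ (QuotientGroup.mk x) = φ (abelianize W (log x)) := by
  refine ⟨Quotient.lift _ fun x y hxy => ?_, hφ.quotient_lift _, fun x => rfl⟩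
  have hl : abelianize W (log (x⁻¹ * y)) ∈ abelianLattice Γ :=
    ⟨_, QuotientGroup.leftRel_apply.1 hxy, rfl⟩
  rw [← hφΓ _ _ hl, ← abelianize_log_mul, mul_inv_cancel_left]

lemma span_abelianLattice_eq_top [CompactSpace (NilGroup W ⧸ Γ)] :
    Submodule.span ℝ (abelianLattice Γ : Set V) = ⊤ := by
  by_contra h
  obtain ⟨ψ, hψ, hψΓ⟩ := Submodule.exists_le_ker_of_lt_top _ (lt_top_iff_ne_top.2 h)
  have hψc : Continuous fun x : NilGroup W => ψ (abelianize W (log x)) :=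
    (ψ ∘ₗ abelianize W).continuous_of_finiteDimensional
  obtain ⟨Ψ, hΨ, hΨ'⟩ := exists_continuous_descend (Γ := Γ) hψc fun v l hl => by
    rw [map_add, LinearMap.mem_ker.1 (hψΓ (Submodule.subset_span hl)), add_zero]
  have hsurj : Function.Surjective Ψ := fun t => by
    obtain ⟨X, hX⟩ := ((LinearMap.surjective hψ).comp abelianize_surjective) t
    exact ⟨QuotientGroup.mk (exp X), (hΨ' _).trans hX⟩
  exact noncompact_univ ℝ (hsurj.range_eq ▸ isCompact_range hΨ)

lemma finite_norm_log_le [DiscreteTopology Γ] (R : ℝ) : {x | x ∈ Γ ∧ ‖log x‖ ≤ R}.Finite := by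
  have hball : IsCompact {x : NilGroup W | ‖log x‖ ≤ R} := by
    have := FiniteDimensional.proper ℝ (LieAlg W)
    rw [← show log ⁻¹' Metric.closedBall 0 R = {x : NilGroup W | ‖log x‖ ≤ R} from
      Set.ext fun x => mem_closedBall_zero_iff]
    exact isCompact_closedBall (0 : LieAlg W) R
  exact (hball.inter_left (Subgroup.isClosed_of_discrete (H := Γ))).finite
    (IsDiscrete.mono ⟨inferInstance⟩ Set.inter_subset_left)

theorem exists_basis_span_int_eq_abelianLattice [DiscreteTopology Γ]
    [CompactSpace (NilGroup W ⧸ Γ)] :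
    ∃ (n : ℕ) (b : Module.Basis (Fin n) ℝ V),
      Submodule.span ℤ (Set.range b) = abelianLattice Γ := by
  obtain ⟨f, hf⟩ := (abelianize W).exists_rightInverse_of_surjective
    (LinearMap.range_eq_top.2 abelianize_surjective)
  have hspan := span_abelianLattice_eq_top (Γ := Γ)
  obtain ⟨R, hR⟩ := exists_norm_sub_le_of_mem_span (centralLattice Γ)
  have hf' : ∀ v, abelianize W (f v) = v := LinearMap.congr_fun hf
  refine exists_basis_span_int_eq (f := f) (Function.LeftInverse.injective hf') hspan
    (((finite_norm_log_le (Γ := Γ) (R + 1)).image fun x => abelianize W (log x)).subset ?_)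
  rintro _ ⟨⟨x, hx, rfl⟩, hx1⟩
  set v := abelianize W (log x)
  have hker : abelianize W (log x - f v) = 0 := by rw [map_sub, hf', sub_self]
  obtain ⟨s, hs, hsR⟩ := hR (log x - f v) (ker_abelianize_le_span_centralLattice hspan hker)
  refine ⟨exp (-s + log x), ⟨?_, ?_⟩, ?_⟩
  · have hs' := neg_mem hs
    rw [exp_add_of_abelianize_eq_zero hs'.1]
    exact Γ.mul_mem hs'.2 hx
  · calc ‖-s + log x‖ = ‖(log x - f v - s) + f v‖ := by congr 1; abel
      _ ≤ R + 1 := norm_add_le_of_le hsR hx1.le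
  · change abelianize W (-s + log x) = v
    rw [map_add, map_neg, hs.1, neg_zero, zero_add]

end Lattice

section Automorphism

variable {V : Type} [AddCommGroup V] [Module ℝ V] [Module.Finite ℝ V]
  {W : Submodule ℝ (⋀[ℝ]^2 V)} {Γ : Subgroup (NilGroup W)} {τ : NilGroup W ≃ₜ* NilGroup W}

lemma map_factor_abelianLattice (hτ : τ '' (Γ : Set (NilGroup W)) = Γ) :
    (abelianLattice Γ).map ((factor τ).restrictScalars ℤ) = abelianLattice Γ := by
  apply le_antisymm
  · rintro _ ⟨_, ⟨x, hx, rfl⟩, rfl⟩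
    exact ⟨τ x, hτ.subset ⟨x, hx, rfl⟩, (factor_proj τ x).symm⟩
  · rintro _ ⟨y, hy, rfl⟩
    obtain ⟨x, hx, rfl⟩ := hτ.superset hy
    exact ⟨_, ⟨x, hx, rfl⟩, factor_proj τ x⟩

lemma iterate_quotientMap_mk (hτ : τ '' (Γ : Set (NilGroup W)) = Γ) (k : ℕ) (x : NilGroup W) :
    (quotientMap τ hτ)^[k] (QuotientGroup.mk x) = QuotientGroup.mk (τ^[k] x) :=
  (Function.Semiconj.iterate_right (f := QuotientGroup.mk) (fun _ => rfl) k x).symm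

lemma abelianize_log_iterate (k : ℕ) (x : NilGroup W) :
    abelianize W (log (τ^[k] x)) = (factor τ ^ k) (abelianize W (log x)) := by
  rw [Module.End.coe_pow]
  exact Function.Semiconj.iterate_right (f := fun x => abelianize W (log x))
    (fun x => (factor_proj τ x).symm) k x

lemma continuous_quotientMap (hτ : τ '' (Γ : Set (NilGroup W)) = Γ) :
    Continuous (quotientMap τ hτ) := τ.continuous.quotient_map' _

variable [DiscreteTopology Γ] [CompactSpace (NilGroup W ⧸ Γ)]

theorem det_factor_sq (hτ : τ '' (Γ : Set (NilGroup W)) = Γ) :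
    LinearMap.det (factor τ) ^ 2 = 1 := by
  obtain ⟨n, b, hb⟩ := exists_basis_span_int_eq_abelianLattice (Γ := Γ)
  have hmap := map_factor_abelianLattice hτ
  rw [← hb] at hmap
  have hT : ∀ x ∈ Submodule.span ℤ (Set.range b),
      (factor τ).restrictScalars ℤ x ∈ Submodule.span ℤ (Set.range b) :=
    Submodule.map_le_iff_le_comap.1 hmap.le
  have := Module.Free.of_basis (b.restrictScalars ℤ)
  have := Module.Finite.of_basis (b.restrictScalars ℤ)
  rw [det_eq_algebraMap_det_restrict b hT, ← map_pow,
    Int.isUnit_sq (isUnit_det_restrict hT hmap.ge), map_one]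

theorem exists_fixed_form_of_factor_pow (hτ : τ '' (Γ : Set (NilGroup W)) = Γ) {k : ℕ} {v : V}
    (hv : v ≠ 0) (hτv : (factor τ ^ k) v = v) :
    ∃ ψ : Module.Dual ℝ V, ψ ≠ 0 ∧ ψ ∘ₗ factor τ ^ k = ψ ∧
      ∀ l ∈ abelianLattice Γ, ∃ n : ℤ, ψ l = n := by
  obtain ⟨n, b, hb⟩ := exists_basis_span_int_eq_abelianLattice (Γ := Γ)
  have hmaps : Set.MapsTo (factor τ) (abelianLattice Γ) (abelianLattice Γ) :=
    Submodule.map_le_iff_le_comap.1 (map_factor_abelianLattice hτ).le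
  rw [← hb] at hmaps ⊢
  refine exists_fixed_integral_form (R := ℤ) b (fun x hx => ?_) hv hτv
  rw [LinearMap.restrictScalars_apply, Module.End.coe_pow]
  exact hmaps.iterate k hx

theorem not_ergodic_quotientMap (hτ : τ '' (Γ : Set (NilGroup W)) = Γ) {k : ℕ} (hk : k ≠ 0)
    {v : V} (hv : v ≠ 0) (hτv : (factor τ ^ k) v = v) (μ : Measure (NilGroup W ⧸ Γ)) [NeZero μ]
    [SMulInvariantMeasure (NilGroup W) (NilGroup W ⧸ Γ) μ] : ¬ Ergodic (quotientMap τ hτ) μ := by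
  intro herg
  obtain ⟨ψ, hψ, hψτ, hψΓ⟩ := exists_fixed_form_of_factor_pow hτ hv hτv
  have hcos : Continuous fun x : NilGroup W =>
      Real.cos (ψ (abelianize W (log x)) * (2 * Real.pi)) :=
    Real.continuous_cos.comp
      ((ψ ∘ₗ abelianize W).continuous_of_finiteDimensional.mul continuous_const)
  obtain ⟨c, hc, hcx⟩ := exists_continuous_descend (Γ := Γ)
    (φ := fun v => Real.cos (ψ v * (2 * Real.pi))) hcos fun v l hl => by
      obtain ⟨n, hn⟩ := hψΓ l hl
      rw [map_add, hn, add_mul, Real.cos_add_int_mul_two_pi]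
  have hck : ∀ q, c ((quotientMap τ hτ)^[k] q) = c q := by
    rintro ⟨x⟩
    change c (_^[k] (QuotientGroup.mk x)) = c (QuotientGroup.mk x)
    rw [iterate_quotientMap_mk, hcx, hcx, abelianize_log_iterate, ← LinearMap.comp_apply, hψτ]
  have hbase : quotientMap τ hτ (QuotientGroup.mk 1) = QuotientGroup.mk 1 :=
    congrArg QuotientGroup.mk (map_one τ)
  have hc1 : c (QuotientGroup.mk 1) = 1 := by
    rw [hcx, log_one, map_zero, map_zero, zero_mul, Real.cos_zero]
  have hmax : ∀ q, c q ≤ c (QuotientGroup.mk 1) := by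
    rintro ⟨x⟩
    rw [hc1]
    exact (hcx x).trans_le (Real.cos_le_one _)
  obtain ⟨X, hX⟩ := ((LinearMap.surjective hψ).comp abelianize_surjective) (1 / 2)
  have := isOpenPosMeasure_of_smulInvariantMeasure (G := NilGroup W) μ
  have h := eq_of_preErgodic_of_forall_le_fixed herg.toPreErgodic (continuous_quotientMap hτ) hc hk
    hck hbase hmax (QuotientGroup.mk (exp X))
  have hX' : ψ (abelianize W X) * (2 * Real.pi) = Real.pi := by
    rw [show ψ (abelianize W X) = 1 / 2 from hX]
    ring
  rw [hc1, hcx, log_exp, hX', Real.cos_pi] at h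
  norm_num at h

end Automorphism

section Anosov

variable {V : Type} [AddCommGroup V] [Module ℝ V] {W : Submodule ℝ (⋀[ℝ]^2 V)}

/-- The linear part `X ↦ X + [X, Y] / 2` of the right translation by `exp Y` in exponential
coordinates; it is the derivative of this translation at every point. -/
def rightMulLinear (Y : LieAlg W) : LieAlg W →ₗ[ℝ] LieAlg W :=
  LinearMap.id + (1 / 2 : ℝ) • (bracket W).flip Y

lemma log_mul_eq_rightMulLinear_add (x y : NilGroup W) :
    log (x * y) = rightMulLinear (log y) (log x) + log y := by
  rw [log_mul, add_right_comm]
  rfl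

lemma rightMulLinear_injective (Y : LieAlg W) : Function.Injective (rightMulLinear Y) := by
  refine (injective_iff_map_eq_zero _).2 fun X (hX : X + (1 / 2 : ℝ) • ⁅X, Y⁆ = 0) => ?_
  have hX₁ : abelianize W X = 0 := by
    have h := congrArg (abelianize W) hX
    rwa [map_add, map_smul, show abelianize W ⁅X, Y⁆ = 0 from rfl, smul_zero, add_zero] at h
  rwa [lie_eq_zero_of_abelianize_eq_zero hX₁, smul_zero, add_zero] at hX

variable [Module.Finite ℝ V] {Γ : Subgroup (NilGroup W)} {τ : NilGroup W ≃ₜ* NilGroup W}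

lemma exists_injective_hasMFDerivAt_mk_one (Γ : Subgroup (NilGroup W)) [DiscreteTopology Γ] :
    ∃ B : LieAlg W →ₗ[ℝ] LieAlg W, Function.Injective B ∧
      HasMFDerivAt 𝓘(ℝ, LieAlg W) 𝓘(ℝ, LieAlg W)
        (QuotientGroup.mk : NilGroup W → NilGroup W ⧸ Γ) 1 B.toContinuousLinearMap := by
  -- The chart of `G/Γ` at the base point is the local inverse of `G → G/Γ` through an arbitrary
  -- lift `g` of the base point, so in charts `G → G/Γ` is the right translation by `g`.
  let g : NilGroup W := Quotient.out (QuotientGroup.mk 1 : NilGroup W ⧸ Γ)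
  refine ⟨rightMulLinear (log g), rightMulLinear_injective _,
    QuotientGroup.continuous_mk.continuousAt, ?_⟩
  have hg : (QuotientGroup.mk 1 : NilGroup W ⧸ Γ) = QuotientGroup.mk g := (Quotient.out_eq _).symm
  have hgΓ : g ∈ Γ := by simpa only [inv_one, one_mul] using QuotientGroup.eq.1 hg
  have hloc := isLocalHomeomorph_mk Γ
  have hinv : ∀ z ∈ (hloc.localInverseAt g).target,
      hloc.localInverseAt g (QuotientGroup.mk z) = z := fun z hz => by
    simpa only [hloc.localInverseAt_symm] using (hloc.localInverseAt g).right_inv hz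
  have hnear : ∀ᶠ u : NilGroup W in nhds 1, u * g ∈ (hloc.localInverseAt g).target :=
    (continuous_mul_const g).continuousAt.eventually_mem (by
      rw [one_mul]
      exact (hloc.localInverseAt g).open_target.mem_nhds hloc.self_mem_localInverseAt_target)
  have hwritten : writtenInExtChartAt 𝓘(ℝ, LieAlg W) 𝓘(ℝ, LieAlg W) (1 : NilGroup W)
      (QuotientGroup.mk : NilGroup W → NilGroup W ⧸ Γ) =ᶠ[nhds (log 1)]
      fun u => rightMulLinear (log g) u + log g := by
    filter_upwards [hnear] with (u : NilGroup W) hu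
    have hug := hinv _ hu
    rw [QuotientGroup.mk_mul_of_mem _ hgΓ] at hug
    exact (congrArg log hug).trans (log_mul_eq_rightMulLinear_add (exp u) g)
  have hderiv := ((rightMulLinear (log g)).toContinuousLinearMap.hasFDerivAt (x := log 1)).add_const
    (log g) |>.congr_of_eventuallyEq hwritten
  exact hderiv.hasFDerivWithinAt

lemma hasMFDerivAt_one (τ : NilGroup W ≃ₜ* NilGroup W) :
    HasMFDerivAt 𝓘(ℝ, LieAlg W) 𝓘(ℝ, LieAlg W) τ 1 (lieMap τ).toContinuousLinearMap :=
  ⟨τ.continuous.continuousAt,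
    ((lieMap τ).toContinuousLinearMap.hasFDerivAt (x := log 1)).hasFDerivWithinAt⟩

lemma exists_lieMap_pow_fixed {k : ℕ} {v : V} (hv : v ≠ 0) (hτv : (factor τ ^ k) v = v) :
    ∃ X : LieAlg W, X ≠ 0 ∧ (lieMap τ ^ k) X = X := by
  obtain ⟨χ, hχ, hτχ⟩ := (exists_fixed_ne_zero_iff_exists_fixed_form _).1 ⟨v, hv, hτv⟩
  refine (exists_fixed_ne_zero_iff_exists_fixed_form _).2 ⟨χ ∘ₗ abelianize W, fun h => hχ ?_, ?_⟩
  · exact (LinearMap.cancel_right abelianize_surjective).1 (h.trans (LinearMap.zero_comp _).symm)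
  · have hpow : (factor τ ^ k) ∘ₗ abelianize W = abelianize W ∘ₗ (lieMap τ ^ k) :=
      Module.End.commute_pow_left_of_commute
        (LinearMap.ext fun X => (abelianize_lieMap τ X).symm) k
    rw [LinearMap.comp_assoc, ← hpow, ← LinearMap.comp_assoc, hτχ]

theorem not_isAnosovDiffeomorph_quotientMap [DiscreteTopology Γ]
    (hτ : τ '' (Γ : Set (NilGroup W)) = Γ) {k : ℕ} (hk : k ≠ 0) {v : V} (hv : v ≠ 0)
    (hτv : (factor τ ^ k) v = v) : ¬ IsAnosovDiffeomorph 𝓘(ℝ, LieAlg W) (quotientMap τ hτ) := by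
  intro hf
  have hfix : quotientMap τ hτ (QuotientGroup.mk 1) = QuotientGroup.mk 1 :=
    congrArg (QuotientGroup.mk (s := Γ)) (map_one τ)
  obtain ⟨D, hD⟩ : ∃ D : LieAlg W →L[ℝ] LieAlg W,
      HasMFDerivAt 𝓘(ℝ, LieAlg W) 𝓘(ℝ, LieAlg W) (quotientMap τ hτ)
        (QuotientGroup.mk 1 : NilGroup W ⧸ Γ) D := by
    obtain ⟨⟨Φ, hΦ⟩, -⟩ := hf
    exact ⟨_, hΦ ▸ (Φ.contMDiff.mdifferentiable one_ne_zero _).hasMFDerivAt⟩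
  obtain ⟨B, hB, hmk⟩ := exists_injective_hasMFDerivAt_mk_one Γ
  have hDB : (D : LieAlg W →ₗ[ℝ] LieAlg W) ∘ₗ B = B ∘ₗ lieMap τ :=
    congrArg ContinuousLinearMap.toLinearMap <| hasMFDerivAt_unique
      (hasMFDerivAt_comp_of_eq hD hmk rfl)
      (hasMFDerivAt_comp_of_eq (f := τ) hmk (hasMFDerivAt_one τ) (map_one τ))
  obtain ⟨X, hX, hτX⟩ := exists_lieMap_pow_fixed hv hτv
  have hBX : (D ^ k) (B X) = B X := by
    rw [← ContinuousLinearMap.coe_coe, ContinuousLinearMap.toLinearMap_pow]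
    exact (LinearMap.congr_fun (Module.End.commute_pow_left_of_commute hDB k) X).trans
      (congrArg B hτX)
  exact hX (hB ((hf.eq_zero_of_hasMFDerivAt_of_pow_apply_eq hfix hD hk hBX).trans
    (map_zero B).symm))

end Anosov

end TwoStep

end

theorem mainTheorem5 :
    (∀ τ : TwoStep.G ≃ₜ* TwoStep.G, LinearMap.det (TwoStep.factor τ) = 1 →
      ∃ v : TwoStep.V, v ≠ 0 ∧ TwoStep.factor τ v = v) ∧
    (∀ (Γ : Subgroup TwoStep.G) [DiscreteTopology Γ] [CompactSpace (TwoStep.G ⧸ Γ)]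
      (τ : TwoStep.G ≃ₜ* TwoStep.G) (hτ : τ '' (Γ : Set TwoStep.G) = Γ),
      ¬ IsAnosovDiffeomorph 𝓘(ℝ, TwoStep.LieAlg TwoStep.W) (TwoStep.quotientMap τ hτ) ∧
      ∀ (μ : Measure (TwoStep.G ⧸ Γ)) [IsProbabilityMeasure μ]
        [SMulInvariantMeasure TwoStep.G (TwoStep.G ⧸ Γ) μ],
        ¬ Ergodic (TwoStep.quotientMap τ hτ) μ) := by
  refine ⟨fun τ hτ => ?_, fun Γ _ _ τ hτ => ?_⟩
  · simpa only [pow_one] using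
      TwoStep.exists_fixed_vector_of_det_factor_pow (k := 1) ((pow_one _).trans hτ)
  · obtain ⟨v, hv, hτv⟩ :=
      TwoStep.exists_fixed_vector_of_det_factor_pow (TwoStep.det_factor_sq hτ)
    exact ⟨TwoStep.not_isAnosovDiffeomorph_quotientMap hτ two_ne_zero hv hτv,
      fun μ _ _ => TwoStep.not_ergodic_quotientMap hτ two_ne_zero hv hτv μ⟩
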